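/- A (finite, compact) metric graph $G$ is obtained from finitely many intervals $[0,\ell_e]$, $\ell_e>0$ ($e\in\mathcal E$), by gluing their ends together at finitely many vertices; the degree of a vertex is the number of edge ends glued there, a leaf is a vertex of degree $1$, and $G$ is a tree if it is connected and has no cycles. For a bounded measurable potential $q:G\to\mathbb R$ let $\lambda_1(G,q)\le\lambda_2(G,q)\le\dots$ be the eigenvalues, counted with multiplicity, of the operator $-u''+qu$ on $L^2(G)$ with standard vertex conditions ($u$ is continuous on $G$, and at every vertex the derivatives of $u$ along the incident edges, directed away from the vertex, sum to $0$), and let $\Gamma[q]=\lambda_2(G,q)-\lambda_1(G,q)$. If $G$ is a tree and $M>0$, let $C_{G,M}$ be the set of all $q:G\to\mathbb R$ with $0\le q\le M$ that are convex along each path joining two distinct leaves of $G$, each such path being regarded, via arc length, as a compact interval. Let $G$ be a tree of total length $L=\sum_{e}\ell_e>0$. Suppose that there are a real eigenfunction $u_2$ of the Laplacian ($q=0$) on $G$ for the eigenvalue $\lambda_2(G,0)$ and a leaf $v$ of $G$ such that $$u_2(v)^2<\frac1L\int_G u_2(x)^2\,\mathrm dx .$$ Then, for every $M>0$, the potential $q=0$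 does not minimize $\Gamma$ in $C_{G,M}$, i.e. there is $q\in C_{G,M}$ with $\Gamma[q]<\Gamma[0]$. In particular, this conclusion holds if some eigenfunction $u_2$ for $\lambda_2(G,0)$ satisfies $u_2(v)=0$ at some leaf $v$. -/

import Mathlib

open Set MeasureTheory

/-- A finite metric graph: every edge `e` is a compact interval `[0, len e]`, with the end `0` glued
to the vertex `src e` and the end `len e` glued to the vertex `tgt e`. Loops and parallel edges are
allowed; the orientation of the edges is only a choice of coordinates. -/
structure MetricGraph (V E : Type*) where
  src : E → V
  tgt : E → V
  len : E → ℝ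
  len_pos : ∀ e, 0 < len e

namespace MetricGraph

/-- The points of the metric graph: vertices, and interior points of edges. -/
inductive Point {V E : Type*} (G : MetricGraph V E) : Type _ where
  | vertex (v : V) : Point G
  | interior (e : E) (x : ℝ) (hx : x ∈ Ioo 0 (G.len e)) : Point G

section

variable {V E : Type*} (G : MetricGraph V E)

/-- The point of `G` with coordinate `x ∈ [0, len e]` on the edge `e`. -/
noncomputable def pt (e : E) (x : ℝ) : G.Point :=
  if hx : x ∈ Ioo 0 (G.len e) then Point.interior e x hx
  else if x ≤ 0 then Point.vertex (G.src e) else Point.vertex (G.tgt e)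

/-- Adjacency of distinct vertices. -/
def toSimpleGraph : SimpleGraph V :=
  SimpleGraph.fromRel fun a b => ∃ e, G.src e = a ∧ G.tgt e = b

/-- `G` is connected and has no cycles: there are no loops (cycles with one edge), no parallel edges
(cycles with two edges), and the adjacency graph is connected and without cycles. -/
structure IsTree : Prop where
  loopless : ∀ e, G.src e ≠ G.tgt e
  no_parallel : ∀ e f, s(G.src e, G.tgt e) = s(G.src f, G.tgt f) → e = f
  isTree : G.toSimpleGraph.IsTree

/-! ### Paths of edges, parametrized by arc length -/

/-- The initial vertex of an edge traversed forwards (`true`) or backwards (`false`). -/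
def origin (d : E × Bool) : V := if d.2 then G.src d.1 else G.tgt d.1

/-- The final vertex of an edge traversed forwards (`true`) or backwards (`false`). -/
def terminus (d : E × Bool) : V := if d.2 then G.tgt d.1 else G.src d.1

/-- The list of oriented edges is a walk from the first to the second vertex. -/
def IsWalk : V → List (E × Bool) → V → Prop
  | a, [], b => a = b
  | a, d :: l, b => G.origin d = a ∧ IsWalk (G.terminus d) l b

/-- A walk that visits no vertex twice. -/
def IsPath (a : V) (l : List (E × Bool)) (b : V) : Prop :=
  G.IsWalk a l b ∧ (a :: l.map G.terminus).Nodup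

/-- The length of a walk. -/
def pathLength (l : List (E × Bool)) : ℝ := (l.map fun d => G.len d.1).sum

/-- The point reached at time `t ∈ [0, pathLength l]` on walking along `l` from the given vertex at
unit speed. -/
noncomputable def trace : V → List (E × Bool) → ℝ → G.Point
  | a, [], _ => Point.vertex a
  | _, d :: l, t =>
      if t ≤ G.len d.1 then G.pt d.1 (if d.2 then t else G.len d.1 - t)
      else trace (G.terminus d) l (t - G.len d.1)

end

section

variable {V E : Type*} [DecidableEq V] [Fintype E] (G : MetricGraph V E)

/-- The degree of a vertex: the number of edge ends glued to it. -/
def degree (v : V) : ℕ :=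
  (Finset.univ.filter fun e => G.src e = v).card + (Finset.univ.filter fun e => G.tgt e = v).card

/-- A leaf (boundary vertex) is a vertex of degree one. -/
def IsLeaf (v : V) : Prop := G.degree v = 1

/-- The class `C_{G,M}` of potentials with values in `[0, M]` that are convex along every path from
a leaf to another leaf, the path being regarded as an interval. -/
def convexClass (M : ℝ) : Set (G.Point → ℝ) :=
  {q | (∀ x, 0 ≤ q x ∧ q x ≤ M) ∧
    ∀ a b, G.IsLeaf a → G.IsLeaf b → a ≠ b → ∀ l, G.IsPath a l b →
      ConvexOn ℝ (Icc 0 (G.pathLength l)) fun t => q (G.trace a l t)}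

/-- `u` belongs to the domain of the Schrödinger operators on `G` with Kirchhoff conditions, and
`du e`, `ddu e` are its first and second derivative on the edge `e`. That is: on every edge `u` is
`C¹` up to the ends and `u'` is the primitive of a function `u''` in `L²` (i.e. `u ∈ W^{2,2}`);
`u` is continuous on `G` (being one function on the points of `G`, it has one value at every
vertex); and at every vertex the derivatives in the directions of the incident edges sum to `0`. -/
structure InDomain (u : G.Point → ℝ) (du ddu : E → ℝ → ℝ) : Prop where
  hasDeriv : ∀ e, ∀ x ∈ Icc 0 (G.len e),
    HasDerivWithinAt (fun y => u (G.pt e y)) (du e x) (Icc 0 (G.len e)) x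
  memLp : ∀ e, MemLp (ddu e) 2 (volume.restrict (Ioo 0 (G.len e)))
  primitive : ∀ e, ∀ x ∈ Icc 0 (G.len e), du e x = du e 0 + ∫ y in (0 : ℝ)..x, ddu e y
  kirchhoff : ∀ v, (∑ e with G.src e = v, du e 0) - (∑ e with G.tgt e = v, du e (G.len e)) = 0

/-- `u` is an eigenfunction of `H u = -u'' + q u` (with Kirchhoff conditions) for the eigenvalue
`μ`. -/
def IsEigenfunction (q : G.Point → ℝ) (μ : ℝ) (u : G.Point → ℝ) : Prop :=
  u ≠ 0 ∧ ∃ du ddu : E → ℝ → ℝ, G.InDomain u du ddu ∧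
    ∀ e, ∀ᵐ x ∂(volume.restrict (Ioo 0 (G.len e))),
      -ddu e x + q (G.pt e x) * u (G.pt e x) = μ * u (G.pt e x)

/-- The `n`-th eigenvalue of `-Δ + q` (`n = 1, 2, …`), in increasing order and counted with
multiplicity: the least `μ` such that there are `n` linearly independent eigenfunctions with
eigenvalues at most `μ`. -/
noncomputable def eigenvalue (q : G.Point → ℝ) (n : ℕ) : ℝ :=
  sInf {μ | ∃ w : Fin n → G.Point → ℝ, LinearIndependent ℝ w ∧
    ∀ i, ∃ ν ≤ μ, G.IsEigenfunction q ν (w i)}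

/-- The fundamental gap `Γ[q] = λ₂(q) - λ₁(q)`. -/
noncomputable def gap (q : G.Point → ℝ) : ℝ := G.eigenvalue q 2 - G.eigenvalue q 1

end

section

variable {V E : Type*} [Fintype E] (G : MetricGraph V E)

/-- The total length of `G`. -/
def totalLength : ℝ := ∑ e, G.len e

/-- The integral over `G` with respect to arc length. -/
noncomputable def integral (f : G.Point → ℝ) : ℝ := ∑ e, ∫ x in (0 : ℝ)..G.len e, f (G.pt e x)

end

end MetricGraph

/-!
Nonnegativity of the Dirichlet form makes the constants the ground state of the Laplacian, so the
derivative of `λ₁` at `q = 0` in the direction of a potential `p` is the mean of `p` over `G`, while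
`λ₂` grows at most like the mean of `p` with respect to the density `u₂² / ∫ u₂²`. If
`p = max 0 (δ - dist v ·)` is concentrated near a leaf `v` where `u₂²` is below its mean, then the
second mean is the smaller one, and the gap decreases along `s • p` for small `s > 0`. Such a `p` is
convex along leaf-to-leaf paths because these can meet the pendant edge only at their ends.

Eigenvalues are compared by the direct method: minimizing the Rayleigh quotient on the form domain,
and then on orthogonal complements of eigenvectors already found, produces weak eigenvectors, and by
the du Bois-Reymond lemma these are eigenfunctions satisfying the Kirchhoff conditions.
-/

section Forms

open Filter Topology Module

variable {X : Type*} [NormedAddCommGroup X] [NormedSpace ℝ X] {a b : X →L[ℝ] X →L[ℝ] ℝ}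
  {K : Submodule ℝ X}

theorem form_smul_add_smul (ha : ∀ x y, a x y = a y x) (s t : ℝ) (x y : X) :
    a (s • x + t • y) (s • x + t • y) = s ^ 2 * a x x + 2 * s * t * a x y + t ^ 2 * a y y := by
  simp only [map_add, map_smul, add_apply, smul_apply, smul_eq_mul, ha y x]
  ring

theorem form_sub_self_le (ha : ∀ x y, a x y = a y x) (hnonneg : ∀ x ∈ K, 0 ≤ a x x) {x y : X}
    (hx : x ∈ K) (hy : y ∈ K) : a (x - y) (x - y) ≤ 2 * a x x + 2 * a y y := by
  have hadd := hnonneg _ (K.add_mem hx hy)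
  simp only [map_add, map_sub, add_apply, sub_apply, ha y x] at hadd ⊢
  linarith

theorem form_eq_zero_of_self_eq_zero (ha : ∀ x y, a x y = a y x) (hnonneg : ∀ x ∈ K, 0 ≤ a x x)
    {x : X} (hx : x ∈ K) (hx0 : a x x = 0) {y : X} (hy : y ∈ K) : a x y = 0 := by
  let B : LinearMap.BilinForm ℝ K :=
    LinearMap.mk₂ ℝ (fun x y => a x y) (by simp) (by simp) (by simp) (by simp)
  have hcs : a x y ^ 2 ≤ a x x * a y y :=
    LinearMap.BilinForm.apply_sq_le_of_symm B (fun x => hnonneg x x.2)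
      ⟨fun x y => ha x y⟩ ⟨x, hx⟩ ⟨y, hy⟩
  rw [hx0, zero_mul] at hcs
  exact pow_eq_zero_iff two_ne_zero |>.1 (le_antisymm hcs (sq_nonneg _))

theorem continuous_form_self (a : X →L[ℝ] X →L[ℝ] ℝ) : Continuous fun x => a x x := by
  fun_prop

/-- `u` is an eigenvector, in the weak sense, of the form `a` on `K` relative to the form `b`. -/
def IsWeakEigenvector (a b : X →L[ℝ] X →L[ℝ] ℝ) (K : Submodule ℝ X) (μ : ℝ) (u : X) : Prop :=
  u ∈ K ∧ ∀ h ∈ K, a u h = μ * b u h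

/-- The setting of the direct method for the Rayleigh quotient `a x x / b x x` on the closed
subspace `K`: `a` satisfies a Gårding inequality relative to `b`, and bounded sequences have
subsequences that are Cauchy for the seminorm of `b`. -/
structure IsRayleighCompact (a b : X →L[ℝ] X →L[ℝ] ℝ) (K : Submodule ℝ X) : Prop where
  symm_left : ∀ x y, a x y = a y x
  symm_right : ∀ x y, b x y = b y x
  nonneg : ∀ x, 0 ≤ b x x
  isClosed : IsClosed (K : Set X)
  garding : ∃ C γ : ℝ, 0 < C ∧ ∀ x ∈ K, ‖x‖ ^ 2 ≤ C * (a x x + γ * b x x)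
  compact : ∀ (x : ℕ → X) (R : ℝ), (∀ n, ‖x n‖ ≤ R) → ∃ φ : ℕ → ℕ, StrictMono φ ∧
    Tendsto (fun p : ℕ × ℕ => b (x (φ p.1) - x (φ p.2)) (x (φ p.1) - x (φ p.2))) atTop (𝓝 0)

namespace IsRayleighCompact

theorem mono {W : Submodule ℝ X} (h : IsRayleighCompact a b K) (hW : IsClosed (W : Set X))
    (hWK : W ≤ K) : IsRayleighCompact a b W :=
  { h with
    isClosed := hW
    garding := let ⟨C, γ, hC, hle⟩ := h.garding; ⟨C, γ, hC, fun x hx => hle x (hWK hx)⟩ }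

theorem exists_lower_bound (h : IsRayleighCompact a b K) :
    ∃ γ, ∀ x ∈ K, -γ * b x x ≤ a x x := by
  obtain ⟨C, γ, hC, hle⟩ := h.garding
  refine ⟨γ, fun x hx => ?_⟩
  have := nonneg_of_mul_nonneg_right ((sq_nonneg ‖x‖).trans (hle x hx)) hC
  linarith

theorem self_pos_of_isWeakEigenvector (h : IsRayleighCompact a b K) {μ : ℝ} {u : X}
    (hu : IsWeakEigenvector a b K μ u) (hu0 : u ≠ 0) : 0 < b u u := by
  obtain ⟨C, γ, -, hle⟩ := h.garding
  refine (h.nonneg u).lt_of_ne fun hbu => ?_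
  have hnorm := hle u hu.1
  rw [hu.2 u hu.1, ← hbu, mul_zero, mul_zero, add_zero, mul_zero] at hnorm
  exact (pow_pos (norm_pos_iff.2 hu0) 2).not_ge hnorm

theorem le_of_isWeakEigenvector (h : IsRayleighCompact a b K) {c μ : ℝ}
    (hc : ∀ x ∈ K, c * b x x ≤ a x x) {u : X} (hu : IsWeakEigenvector a b K μ u) (hu0 : u ≠ 0) :
    c ≤ μ :=
  le_of_mul_le_mul_right (hu.2 u hu.1 ▸ hc u hu.1) (h.self_pos_of_isWeakEigenvector hu hu0)

theorem exists_minimizing_seq (h : IsRayleighCompact a b K) {z : X} (hz : z ∈ K)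
    (hbz : 0 < b z z) :
    ∃ μ, (∀ x ∈ K, μ * b x x ≤ a x x) ∧ ∃ x : ℕ → X, (∀ n, x n ∈ K ∧ b (x n) (x n) = 1) ∧
      Tendsto (fun n => a (x n) (x n)) atTop (𝓝 μ) := by
  obtain ⟨γ, hγ⟩ := h.exists_lower_bound
  let S : Set ℝ := {r | ∃ x, (x ∈ K ∧ b x x = 1) ∧ a x x = r}
  have quotient_mem : ∀ x ∈ K, 0 < b x x → a x x / b x x ∈ S := fun x hx hbx => by
    have hsq : (√(b x x))⁻¹ * (√(b x x))⁻¹ = (b x x)⁻¹ := by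
      rw [← mul_inv, Real.mul_self_sqrt hbx.le]
    refine ⟨(√(b x x))⁻¹ • x, ⟨K.smul_mem _ hx, ?_⟩, ?_⟩ <;>
      simp only [map_smul, smul_apply, smul_eq_mul, ← mul_assoc, hsq]
    · exact inv_mul_cancel₀ hbx.ne'
    · exact inv_mul_eq_div _ _
  have hne : S.Nonempty := ⟨_, quotient_mem z hz hbz⟩
  have hbdd : BddBelow S := ⟨-γ, by
    rintro _ ⟨x, ⟨hx, hbx⟩, rfl⟩
    simpa [hbx] using hγ x hx⟩
  obtain ⟨r, -, hr, hrS⟩ := exists_seq_tendsto_sInf hne hbdd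
  choose x hx hax using hrS
  refine ⟨sInf S, fun y hy => ?_, x, hx, by simpa only [hax] using hr⟩
  rcases (h.nonneg y).eq_or_lt with hby | hby
  · simpa [← hby] using hγ y hy
  · exact (le_div_iff₀ hby).1 (csInf_le hbdd (quotient_mem y hy hby))

theorem exists_cauchySeq_of_minimizing (h : IsRayleighCompact a b K) {μ : ℝ}
    (hμ : ∀ x ∈ K, μ * b x x ≤ a x x) {x : ℕ → X} (hx : ∀ n, x n ∈ K ∧ b (x n) (x n) = 1)
    (hax : Tendsto (fun n => a (x n) (x n)) atTop (𝓝 μ)) :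
    ∃ φ : ℕ → ℕ, StrictMono φ ∧ CauchySeq (x ∘ φ) := by
  obtain ⟨C, γ, hC, hle⟩ := h.garding
  obtain ⟨A, hA⟩ := hax.bddAbove_range
  have hbdd : ∀ n, ‖x n‖ ≤ √(C * (A + γ)) := fun n => by
    refine Real.le_sqrt_of_sq_le ((hle _ (hx n).1).trans ?_)
    rw [(hx n).2, mul_one]
    gcongr
    exact hA ⟨n, rfl⟩
  obtain ⟨φ, hφ, hb⟩ := h.compact x _ hbdd
  -- `Q` is nonnegative and tends to `0` along `x`, so that its parallelogram identity controls the
  -- differences of the `x n`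
  let Q := a - μ • b
  have hQ : Tendsto (fun n => Q (x (φ n)) (x (φ n))) atTop (𝓝 0) := by
    simpa [Q, (hx _).2, Function.comp_def] using (hax.comp hφ.tendsto_atTop).sub_const μ
  have hdist (p : ℕ × ℕ) : dist (x (φ p.1)) (x (φ p.2)) ^ 2 ≤
      C * (2 * Q (x (φ p.1)) (x (φ p.1)) + 2 * Q (x (φ p.2)) (x (φ p.2)) +
        (μ + γ) * b (x (φ p.1) - x (φ p.2)) (x (φ p.1) - x (φ p.2))) := by
    rw [dist_eq_norm]
    refine (hle _ (K.sub_mem (hx _).1 (hx _).1)).trans (mul_le_mul_of_nonneg_left ?_ hC.le)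
    have hsub := form_sub_self_le (a := Q) (fun x y => by simp [Q, h.symm_left x, h.symm_right x])
      (fun x hx => by simpa [Q] using hμ x hx) (hx (φ p.1)).1 (hx (φ p.2)).1
    have : Q (x (φ p.1) - x (φ p.2)) (x (φ p.1) - x (φ p.2)) =
      a (x (φ p.1) - x (φ p.2)) (x (φ p.1) - x (φ p.2)) -
        μ * b (x (φ p.1) - x (φ p.2)) (x (φ p.1) - x (φ p.2)) := rfl
    linarith
  refine ⟨φ, hφ, cauchySeq_iff_tendsto_dist_atTop_0.2 ?_⟩
  have hQ₁ := hQ.comp (g := fun n => Q (x (φ n)) (x (φ n))) (f := Prod.fst)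
    (tendsto_fst (α := ℕ) (β := ℕ) |>.mono_left prod_atTop_atTop_eq.ge)
  have hQ₂ := hQ.comp (g := fun n => Q (x (φ n)) (x (φ n))) (f := Prod.snd)
    (tendsto_snd (α := ℕ) (β := ℕ) |>.mono_left prod_atTop_atTop_eq.ge)
  have hbound := (((hQ₁.const_mul 2).add (hQ₂.const_mul 2)).add (hb.const_mul (μ + γ))).const_mul C
  simp only [mul_zero, add_zero] at hbound
  have hsq := squeeze_zero (fun p => sq_nonneg _) hdist hbound
  simpa [Real.sqrt_sq dist_nonneg] using hsq.sqrt

theorem exists_minimizer [CompleteSpace X] (h : IsRayleighCompact a b K) {z : X} (hz : z ∈ K)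
    (hbz : 0 < b z z) :
    ∃ u μ, IsWeakEigenvector a b K μ u ∧ b u u = 1 ∧ ∀ x ∈ K, μ * b x x ≤ a x x := by
  obtain ⟨μ, hμ, x, hx, hax⟩ := h.exists_minimizing_seq hz hbz
  obtain ⟨φ, hφ, hcauchy⟩ := h.exists_cauchySeq_of_minimizing hμ hx hax
  obtain ⟨u, hu⟩ := cauchySeq_tendsto_of_complete hcauchy
  have huK : u ∈ K := h.isClosed.mem_of_tendsto hu (Eventually.of_forall fun n => (hx _).1)
  have hbu : b u u = 1 := tendsto_nhds_unique (((continuous_form_self b).tendsto u).comp hu) <| by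
    simp [Function.comp_def, (hx _).2]
  have hau : a u u = μ := tendsto_nhds_unique (((continuous_form_self a).tendsto u).comp hu)
    (hax.comp hφ.tendsto_atTop)
  refine ⟨u, μ, ⟨huK, fun y hy => ?_⟩, hbu, hμ⟩
  have := form_eq_zero_of_self_eq_zero (a := a - μ • b)
    (fun x y => by simp [h.symm_left x, h.symm_right x]) (fun x hx => by simpa using hμ x hx)
    huK (by simp [hau, hbu]) hy
  simpa [sub_eq_zero] using this

end IsRayleighCompact

theorem IsWeakEigenvector.of_inf_ker {u w : X} {μ ν : ℝ} (ha : ∀ x y, a x y = a y x)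
    (hb : ∀ x y, b x y = b y x) (hu : IsWeakEigenvector a b K μ u) (hbu : b u u = 1)
    (hw : IsWeakEigenvector a b (K ⊓ (b u).toLinearMap.ker) ν w) :
    IsWeakEigenvector a b K ν w := by
  obtain ⟨⟨hwK, hbuw : b u w = 0⟩, hw⟩ := hw
  refine ⟨hwK, fun h hh => ?_⟩
  have hproj := hw (h - b u h • u) ⟨K.sub_mem hh (K.smul_mem _ hu.1), by simp [hbu]⟩
  simpa [ha w u, hb w u, hu.2 w hwK, hbuw] using hproj

theorem le_finrank_inf_ker {F : Submodule ℝ X} {n : ℕ} (hF : n + 1 ≤ finrank ℝ F)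
    (f : X →ₗ[ℝ] ℝ) : n ≤ finrank ℝ (F ⊓ f.ker : Submodule ℝ X) := by
  have : FiniteDimensional ℝ F := finite_of_finrank_pos (by lia)
  have hrank := (f.domRestrict F).finrank_range_add_finrank_ker
  have hrange := (f.domRestrict F).range.finrank_le
  have hmap : (f.domRestrict F).ker.map F.subtype = F ⊓ f.ker := by
    ext x
    simp [and_comm]
  rw [finrank_self] at hrange
  rw [← hmap, Submodule.finrank_map_subtype_eq]
  lia

theorem IsRayleighCompact.exists_orthonormal_eigenvectors [CompleteSpace X] {Λ : ℝ} {n : ℕ}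
    (h : IsRayleighCompact a b K) {F : Submodule ℝ X} (hFK : F ≤ K) (hF : n ≤ finrank ℝ F)
    (hpos : ∀ x ∈ F, x ≠ 0 → 0 < b x x) (hle : ∀ x ∈ F, a x x ≤ Λ * b x x) :
    ∃ u : Fin n → X, (∀ i, ∃ μ ≤ Λ, IsWeakEigenvector a b K μ (u i)) ∧
      ∀ i j, b (u i) (u j) = if i = j then 1 else 0 := by
  induction n generalizing K F with
  | zero => exact ⟨Fin.elim0, Fin.rec0, Fin.rec0⟩
  | succ n ih =>
    have : FiniteDimensional ℝ F := finite_of_finrank_pos (hF.trans_lt' n.succ_pos)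
    obtain ⟨⟨z, hzF⟩, hz⟩ := finrank_pos_iff_exists_ne_zero.1 (hF.trans_lt' n.succ_pos)
    have hbz := hpos z hzF (by simpa using hz)
    obtain ⟨u, μ, hu, hbu, hmin⟩ := h.exists_minimizer (hFK hzF) hbz
    have hclosed : IsClosed ((K ⊓ (b u).toLinearMap.ker : Submodule ℝ X) : Set X) :=
      h.isClosed.inter (b u).isClosed_ker
    obtain ⟨w, hw, horth⟩ := ih (h.mono hclosed inf_le_left)
      (inf_le_inf_right _ hFK) (le_finrank_inf_ker hF (b u).toLinearMap)
      (fun x hx => hpos x hx.1) (fun x hx => hle x hx.1)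
    have hbuw (i) : b u (w i) = 0 := let ⟨_, _, hwi⟩ := hw i; hwi.1.2
    refine ⟨Fin.cons u w, Fin.cases ⟨μ, ?_, hu⟩ fun i => ?_, Fin.cases ?_ fun i => ?_⟩
    · exact le_of_mul_le_mul_right ((hmin z (hFK hzF)).trans (hle z hzF)) hbz
    · obtain ⟨ν, hν, hwi⟩ := hw i
      exact ⟨ν, hν, hu.of_inf_ker h.symm_left h.symm_right hbu hwi⟩
    · exact Fin.cases (by simpa using hbu) fun j => by simp [hbuw, (Fin.succ_ne_zero j).symm]
    · exact Fin.cases (by simp [h.symm_right _ u, hbuw]) fun j => by simp [horth]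

end Forms

section Perturbation

open Filter Topology

variable {X : Type*} [NormedAddCommGroup X] [NormedSpace ℝ X] {B D W : X →L[ℝ] X →L[ℝ] ℝ}
  {K : Submodule ℝ X} {δ lam : ℝ}

theorem two_mul_abs_form_le (hB : ∀ x y, B x y = B y x) (hW : ∀ x y, W x y = W y x)
    (hWB : ∀ x, |W x x| ≤ δ * B x x) {θ : ℝ} (hθ : 0 < θ) (x y : X) :
    2 * |W x y| ≤ δ * (θ * B x x + θ⁻¹ * B y y) := by
  have hplus := abs_le.1 (hWB (θ • x + (1 : ℝ) • y))
  have hminus := abs_le.1 (hWB (θ • x + (-1 : ℝ) • y))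
  rw [form_smul_add_smul hW, form_smul_add_smul hB] at hplus hminus
  have hscaled : |θ * (2 * W x y)| ≤ θ * (δ * (θ * B x x + θ⁻¹ * B y y)) := by
    have : θ * (δ * (θ * B x x + θ⁻¹ * B y y)) = δ * (θ ^ 2 * B x x + B y y) := by
      field_simp
    rw [this, abs_le]
    constructor <;> linarith
  rw [abs_mul, abs_of_pos hθ, abs_mul, abs_two] at hscaled
  exact le_of_mul_le_mul_left hscaled hθ

theorem eventually_nhdsGT_zero_mul_le (hlam : 0 < lam) (c : ℝ) :
    ∀ᶠ s : ℝ in 𝓝[>] 0, 0 < s ∧ s * c ≤ lam := by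
  have hlim : Tendsto (fun s : ℝ => s * c) (𝓝[>] 0) (𝓝 0) :=
    ((continuous_mul_const c).tendsto' 0 0 (zero_mul c)).mono_left nhdsWithin_le_nhds
  filter_upwards [self_mem_nhdsWithin, hlim.eventually_le_const hlam] with s hs hsc
  exact ⟨hs, hsc⟩

theorem eventually_mul_form_le_form_add_smul (hB : ∀ x y, B x y = B y x)
    (hD : ∀ x y, D x y = D y x) (hW : ∀ x y, W x y = W y x) (hB₀ : ∀ x, 0 ≤ B x x)
    (hWB : ∀ x, |W x x| ≤ δ * B x x) {e : X} (heK : e ∈ K) (hBe : 0 < B e e)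
    (hDe : ∀ x, D e x = 0) (hlam : 0 < lam)
    (hgap : ∀ z ∈ K, B e z = 0 → lam * B z z ≤ D z z) {a : ℝ} (ha : a * B e e < W e e) :
    ∀ᶠ s : ℝ in 𝓝[>] 0, ∀ x ∈ K, s * a * B x x ≤ D x x + s * W x x := by
  have hδ : 0 ≤ δ := nonneg_of_mul_nonneg_left ((abs_nonneg _).trans (hWB e)) hBe
  obtain ⟨θ, hθ, hθe⟩ : ∃ θ > 0, δ * θ * B e e ≤ W e e - a * B e e := by
    refine ⟨(W e e - a * B e e) / ((δ + 1) * B e e), div_pos (by linarith) (by positivity), ?_⟩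
    field_simp
    nlinarith
  filter_upwards [eventually_nhdsGT_zero_mul_le hlam (a + δ * θ⁻¹ + δ)] with s ⟨hs, hslam⟩ x hx
  obtain ⟨t, z, hz, hBz, rfl⟩ : ∃ t, ∃ z ∈ K, B e z = 0 ∧ x = t • e + (1 : ℝ) • z :=
    ⟨B e x / B e e, x - (B e x / B e e) • e, K.sub_mem hx (K.smul_mem _ heK), by
      simp [hBe.ne'], by simp⟩
  rw [form_smul_add_smul hB, form_smul_add_smul hD, form_smul_add_smul hW, hBz, hDe, hDe]
  have hcross : -(δ * (θ * (t ^ 2 * B e e) + θ⁻¹ * B z z)) ≤ 2 * (t * W e z) := by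
    have := two_mul_abs_form_le hB hW hWB hθ (t • e) z
    simp only [map_smul, smul_apply, smul_eq_mul] at this
    have := neg_abs_le (t * W e z)
    linarith
  have hWz := (abs_le.1 (hWB z)).1
  have hDz := hgap z hz hBz
  have hsBz := mul_le_mul_of_nonneg_right hslam (hB₀ z)
  have hst := mul_le_mul_of_nonneg_left hθe (by positivity : 0 ≤ s * t ^ 2)
  have hscross := mul_le_mul_of_nonneg_left (add_le_add hcross hWz) hs.le
  linarith

theorem finrank_span_pair_of_form_eq_zero {e k : X} (hB : ∀ x y, B x y = B y x)
    (hBe : 0 < B e e) (hBk : 0 < B k k) (hBek : B e k = 0) :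
    Module.finrank ℝ (Submodule.span ℝ {e, k}) = 2 := by
  have hind : LinearIndependent ℝ ![e, k] := LinearIndependent.pair_iff.2 fun s t hst => by
    have he := congrArg (B e) hst
    have hk := congrArg (B k) hst
    simp only [map_add, map_smul, smul_eq_mul, hBek, hB k e, mul_zero, add_zero, zero_add,
      map_zero, mul_eq_zero, hBe.ne', hBk.ne', or_false] at he hk
    exact ⟨he, hk⟩
  rw [← Matrix.range_cons_cons_empty e k ![], finrank_span_eq_card hind, Fintype.card_fin]

theorem form_self_pos_of_mem_span_pair {e k : X} (hB : ∀ x y, B x y = B y x)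
    (hBe : 0 < B e e) (hBk : 0 < B k k) (hBek : B e k = 0) {x : X}
    (hx : x ∈ Submodule.span ℝ {e, k}) (hx0 : x ≠ 0) : 0 < B x x := by
  obtain ⟨s, t, rfl⟩ := Submodule.mem_span_pair.1 hx
  rw [form_smul_add_smul hB, hBek, mul_zero, add_zero]
  obtain hs | ht : s ≠ 0 ∨ t ≠ 0 := by
    by_contra! hst
    simp [hst.1, hst.2] at hx0
  all_goals positivity

theorem eventually_form_add_smul_le_on_span_pair (hB : ∀ x y, B x y = B y x)
    (hD : ∀ x y, D x y = D y x) (hW : ∀ x y, W x y = W y x)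
    (hWB : ∀ x, |W x x| ≤ δ * B x x) {e k : X} (hBe : 0 < B e e) (hBk : 0 < B k k)
    (hBek : B e k = 0) (hDe : ∀ x, D e x = 0) (hlam : 0 < lam) (hDk : D k k = lam * B k k)
    {c : ℝ} (hc : W k k < c * B k k) :
    ∀ᶠ s : ℝ in 𝓝[>] 0, ∀ x ∈ Submodule.span ℝ {e, k},
      D x x + s * W x x ≤ (lam + s * c) * B x x := by
  have hδ : 0 ≤ δ := nonneg_of_mul_nonneg_left ((abs_nonneg _).trans (hWB e)) hBe
  obtain ⟨θ, hθ, hθk⟩ : ∃ θ > 0, δ * θ * B k k ≤ c * B k k - W k k := by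
    refine ⟨(c * B k k - W k k) / ((δ + 1) * B k k), div_pos (by linarith) (by positivity), ?_⟩
    field_simp
    nlinarith
  filter_upwards [eventually_nhdsGT_zero_mul_le hlam (δ + δ * θ⁻¹ - c)] with s ⟨hs, hslam⟩ x hx
  obtain ⟨t, r, rfl⟩ := Submodule.mem_span_pair.1 hx
  rw [form_smul_add_smul hB, form_smul_add_smul hD, form_smul_add_smul hW, hBek, hDe, hDe, hDk]
  have hcross : 2 * (t * r * W e k) ≤ δ * (θ * (r ^ 2 * B k k) + θ⁻¹ * (t ^ 2 * B e e)) := by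
    have := two_mul_abs_form_le hB hW hWB hθ (r • k) (t • e)
    simp only [map_smul, smul_apply, smul_eq_mul, hW k e] at this
    have := le_abs_self (t * (r * W e k))
    linarith
  have hWe := (abs_le.1 (hWB e)).2
  have hst := mul_le_mul_of_nonneg_right hslam (by positivity : 0 ≤ t ^ 2 * B e e)
  have hsr := mul_le_mul_of_nonneg_left hθk (by positivity : 0 ≤ s * r ^ 2)
  have hsWe := mul_le_mul_of_nonneg_left hWe (by positivity : 0 ≤ s * t ^ 2)
  have hscross := mul_le_mul_of_nonneg_left hcross hs.le
  linarith

end Perturbation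

theorem abs_intervalIntegral_le_sqrt_mul_norm {μ : Measure ℝ} (hμ : μ ≤ volume) (f : Lp ℝ 2 μ)
    {a b : ℝ} (hab : a ≤ b) : |∫ x in a..b, f x ∂μ| ≤ √(b - a) * ‖f‖ := by
  have hle : μ (Ioc a b) ≤ ENNReal.ofReal (b - a) := Real.volume_Ioc ▸ hμ (Ioc a b)
  have hfin : μ (Ioc a b) ≠ ⊤ := (hle.trans_lt ENNReal.ofReal_lt_top).ne
  rw [intervalIntegral.integral_of_le hab,
    ← L2.inner_indicatorConstLp_one (𝕜 := ℝ) measurableSet_Ioc hfin f, ← Real.norm_eq_abs]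
  refine (norm_inner_le_norm _ _).trans (mul_le_mul_of_nonneg_right ?_ (norm_nonneg _))
  rw [norm_indicatorConstLp (by norm_num) (by norm_num), norm_one, one_mul, Real.sqrt_eq_rpow,
    ENNReal.toReal_ofNat]
  exact Real.rpow_le_rpow measureReal_nonneg
    (ENNReal.toReal_le_of_le_ofReal (sub_nonneg.2 hab) hle) (by norm_num)

/-- The symmetric bilinear form `(f, g) ↦ ∫ p f g` on `[0, ℓ]`. -/
noncomputable def intervalForm (p : C(ℝ, ℝ)) (ℓ : ℝ) : LinearMap.BilinForm ℝ C(ℝ, ℝ) :=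
  LinearMap.mk₂ ℝ (fun f g => ∫ x in (0 : ℝ)..ℓ, p x * (f x * g x))
    (fun f f' g => by
      rw [← intervalIntegral.integral_add] <;> first
        | exact Continuous.intervalIntegrable (by fun_prop) _ _
        | simp only [ContinuousMap.add_apply, add_mul, mul_add])
    (fun c f g => by
      rw [smul_eq_mul, ← intervalIntegral.integral_const_mul]
      simp only [ContinuousMap.smul_apply, smul_eq_mul, mul_assoc, mul_left_comm c])
    (fun f g g' => by
      rw [← intervalIntegral.integral_add] <;> first
        | exact Continuous.intervalIntegrable (by fun_prop) _ _
        | simp only [ContinuousMap.add_apply, mul_add])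
    (fun c f g => by
      rw [smul_eq_mul, ← intervalIntegral.integral_const_mul]
      simp only [ContinuousMap.smul_apply, smul_eq_mul, mul_left_comm c])

namespace MetricGraph

section Sobolev

variable {V E : Type*} (G : MetricGraph V E)

/-- Arc length on an edge. -/
noncomputable abbrev edgeMeasure (e : E) : Measure ℝ := volume.restrict (Ioc 0 (G.len e))

/-- Values at the vertices and square integrable derivatives on the edges: the coordinates in which
the Sobolev space of `G` is described. -/
abbrev SobolevPair : Type _ := (V → ℝ) × (∀ e, Lp ℝ 2 (G.edgeMeasure e))

variable {G}

theorem intervalIntegrable_edgeMeasure {e : E} (f : Lp ℝ 2 (G.edgeMeasure e)) (a b : ℝ) :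
    IntervalIntegrable f (G.edgeMeasure e) a b :=
  ((Lp.memLp f).integrable one_le_two).intervalIntegrable

theorem intervalIntegrable_volume {e : E} (f : Lp ℝ 2 (G.edgeMeasure e)) :
    IntervalIntegrable f volume 0 (G.len e) :=
  (intervalIntegrable_iff_integrableOn_Ioc_of_le (G.len_pos e).le).2
    ((Lp.memLp f).integrable one_le_two)

theorem intervalIntegral_edgeMeasure {e : E} (f : ℝ → ℝ) {x : ℝ} (hx : x ∈ Icc 0 (G.len e)) :
    ∫ y in (0 : ℝ)..x, f y ∂G.edgeMeasure e = ∫ y in (0 : ℝ)..x, f y := by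
  rw [intervalIntegral.integral_of_le hx.1, intervalIntegral.integral_of_le hx.1,
    Measure.restrict_restrict measurableSet_Ioc, inter_eq_left.2 (Ioc_subset_Ioc_right hx.2)]

namespace SobolevPair

/-- The function on the edge `e` with the value of `k` at the initial vertex and the derivative
of `k`. The measure is supported by the edge, so that the function is constant beyond its ends. -/
noncomputable def value (e : E) : G.SobolevPair →ₗ[ℝ] C(ℝ, ℝ) where
  toFun k := ⟨fun x => k.1 (G.src e) + ∫ y in (0 : ℝ)..x, k.2 e y ∂G.edgeMeasure e,
    continuous_const.add (intervalIntegral.continuous_primitive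
      (fun a b => intervalIntegrable_edgeMeasure (k.2 e) a b) 0)⟩
  map_add' k h := by
    ext x
    have hadd : ∫ y in (0 : ℝ)..x, (k + h).2 e y ∂G.edgeMeasure e
        = ∫ y in (0 : ℝ)..x, (k.2 e y + h.2 e y) ∂G.edgeMeasure e :=
      intervalIntegral.integral_congr_ae ((Lp.coeFn_add (k.2 e) (h.2 e)).mono fun _ hy _ => hy)
    simp only [ContinuousMap.coe_mk, ContinuousMap.add_apply, hadd, intervalIntegral.integral_add
      (intervalIntegrable_edgeMeasure (k.2 e) 0 x) (intervalIntegrable_edgeMeasure (h.2 e) 0 x)]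
    exact add_add_add_comm _ _ _ _
  map_smul' c k := by
    ext x
    have hsmul : ∫ y in (0 : ℝ)..x, (c • k).2 e y ∂G.edgeMeasure e
        = ∫ y in (0 : ℝ)..x, c * k.2 e y ∂G.edgeMeasure e :=
      intervalIntegral.integral_congr_ae ((Lp.coeFn_smul c (k.2 e)).mono fun _ hy _ => hy)
    simp only [ContinuousMap.coe_mk, hsmul, intervalIntegral.integral_const_mul]
    exact (mul_add _ _ _).symm

theorem value_apply (k : G.SobolevPair) (e : E) (x : ℝ) :
    value e k x = k.1 (G.src e) + ∫ y in (0 : ℝ)..x, k.2 e y ∂G.edgeMeasure e := rfl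

theorem value_zero (k : G.SobolevPair) (e : E) : value e k 0 = k.1 (G.src e) := by
  simp [value_apply]

theorem value_eq_of_ae_eq {k : G.SobolevPair} {e : E} {f : ℝ → ℝ}
    (hf : k.2 e =ᵐ[G.edgeMeasure e] f) {x : ℝ} (hx : x ∈ Icc 0 (G.len e)) :
    value e k x = k.1 (G.src e) + ∫ y in (0 : ℝ)..x, f y := by
  rw [value_apply, intervalIntegral.integral_congr_ae (hf.mono fun _ hy _ => hy),
    intervalIntegral_edgeMeasure f hx]

theorem value_sub_value (k : G.SobolevPair) (e : E) (x y : ℝ) :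
    value e k y - value e k x = ∫ t in x..y, k.2 e t ∂G.edgeMeasure e := by
  rw [value_apply, value_apply, add_sub_add_left_eq_sub,
    intervalIntegral.integral_interval_sub_left] <;> exact intervalIntegrable_edgeMeasure _ _ _

theorem abs_value_sub_value_le (k : G.SobolevPair) (e : E) (x y : ℝ) :
    |value e k x - value e k y| ≤ √|x - y| * ‖k.2 e‖ := by
  wlog h : y ≤ x generalizing x y
  · rw [abs_sub_comm, abs_sub_comm x]
    exact this y x (le_of_not_ge h)
  rw [value_sub_value, abs_of_nonneg (sub_nonneg.2 h)]
  exact abs_intervalIntegral_le_sqrt_mul_norm Measure.restrict_le_self _ h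

end SobolevPair

open SobolevPair

variable (G) in
/-- The Sobolev space of continuous functions on `G` with square integrable derivative. -/
noncomputable def sobolevSpace : Submodule ℝ G.SobolevPair where
  carrier := {k | ∀ e, value e k (G.len e) = k.1 (G.tgt e)}
  add_mem' hk hh e := by simp [hk e, hh e]
  zero_mem' e := by simp
  smul_mem' c k hk e := by simp [hk e]

variable [Fintype V] [Fintype E]

theorem abs_value_le (k : G.SobolevPair) (e : E) {x : ℝ} (hx : x ∈ Icc 0 (G.len e)) :
    |value e k x| ≤ (1 + √(G.len e)) * ‖k‖ := by
  have hholder := abs_value_sub_value_le k e x 0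
  rw [value_zero, sub_zero, abs_of_nonneg hx.1] at hholder
  have hsrc : |k.1 (G.src e)| ≤ ‖k‖ := (norm_le_pi_norm k.1 (G.src e)).trans (norm_fst_le k)
  have hderiv : √x * ‖k.2 e‖ ≤ √(G.len e) * ‖k‖ :=
    mul_le_mul (Real.sqrt_le_sqrt hx.2) ((norm_le_pi_norm k.2 e).trans (norm_snd_le k))
      (norm_nonneg _) (Real.sqrt_nonneg _)
  have htriangle := abs_add_le (value e k x - k.1 (G.src e)) (k.1 (G.src e))
  rw [sub_add_cancel] at htriangle
  linarith

omit [Fintype V] [Fintype E] in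
theorem isClosed_sobolevSpace [Finite V] [Finite E] :
    IsClosed (G.sobolevSpace : Set G.SobolevPair) := by
  have := Fintype.ofFinite V
  have := Fintype.ofFinite E
  have hset : (G.sobolevSpace : Set G.SobolevPair) =
      ⋂ e, {k | value e k (G.len e) = k.1 (G.tgt e)} := by
    ext k
    exact (mem_iInter (s := fun e => {k | value e k (G.len e) = k.1 (G.tgt e)})).symm
  rw [hset]
  refine isClosed_iInter fun e => isClosed_eq ?_ (by fun_prop)
  let eval : G.SobolevPair →ₗ[ℝ] ℝ :=
    { toFun := fun k => value e k (G.len e)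
      map_add' := by simp
      map_smul' := by simp }
  have hbound := fun k => abs_value_le (G := G) k e (right_mem_Icc.2 (G.len_pos e).le)
  exact (eval.mkContinuous _ hbound).continuous

variable (G) in
/-- The form `∫ u' w'`. -/
noncomputable def dirichletForm : G.SobolevPair →L[ℝ] G.SobolevPair →L[ℝ] ℝ :=
  ∑ e, (innerSL ℝ).bilinearComp (.proj e ∘L .snd ℝ (V → ℝ) (∀ e, Lp ℝ 2 (G.edgeMeasure e)))
    (.proj e ∘L .snd ℝ (V → ℝ) (∀ e, Lp ℝ 2 (G.edgeMeasure e)))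

theorem dirichletForm_apply (k h : G.SobolevPair) :
    G.dirichletForm k h = ∑ e, inner ℝ (k.2 e) (h.2 e) := by
  simp [dirichletForm]

theorem exists_norm_intervalForm_value_le (p : C(ℝ, ℝ)) (e : E) :
    ∃ C, ∀ k h : G.SobolevPair,
      ‖intervalForm p (G.len e) (value e k) (value e h)‖ ≤ C * ‖k‖ * ‖h‖ := by
  obtain ⟨C, hC⟩ := (isCompact_Icc (a := 0) (b := G.len e)).exists_bound_of_continuousOn
    p.continuous.continuousOn
  refine ⟨C * (1 + √(G.len e)) ^ 2 * G.len e, fun k h => ?_⟩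
  have hlen := (G.len_pos e).le
  have hbound : ∀ x ∈ uIoc 0 (G.len e), ‖p x * (value e k x * value e h x)‖ ≤
      C * (((1 + √(G.len e)) * ‖k‖) * ((1 + √(G.len e)) * ‖h‖)) := fun x hx => by
    rw [uIoc_of_le hlen] at hx
    have hx' := Ioc_subset_Icc_self hx
    rw [norm_mul, norm_mul]
    exact mul_le_mul (hC x hx') (mul_le_mul (abs_value_le k e hx') (abs_value_le h e hx')
      (norm_nonneg _) (by positivity)) (by positivity) ((norm_nonneg _).trans (hC x hx'))
  refine (intervalIntegral.norm_integral_le_of_norm_le_const hbound).trans_eq ?_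
  rw [sub_zero, abs_of_nonneg hlen]
  ring

variable (G) in
/-- The form `∫ p u w` for a weight `p` that is continuous on every edge. -/
noncomputable def weightForm (p : E → C(ℝ, ℝ)) : G.SobolevPair →L[ℝ] G.SobolevPair →L[ℝ] ℝ :=
  ∑ e, LinearMap.mkContinuousOfExistsBound₂
    ((intervalForm (p e) (G.len e)).compl₁₂ (value e) (value e))
    (exists_norm_intervalForm_value_le (p e) e)

theorem weightForm_apply (p : E → C(ℝ, ℝ)) (k h : G.SobolevPair) :
    G.weightForm p k h = ∑ e, ∫ x in (0 : ℝ)..G.len e, p e x * (value e k x * value e h x) := by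
  simp only [weightForm, FunLike.coe_sum, Finset.sum_apply]
  rfl

variable (G) in
/-- The inner product `∫ u w` of `L²(G)`. -/
noncomputable abbrev massForm : G.SobolevPair →L[ℝ] G.SobolevPair →L[ℝ] ℝ := G.weightForm 1

theorem massForm_apply (k h : G.SobolevPair) :
    G.massForm k h = ∑ e, ∫ x in (0 : ℝ)..G.len e, value e k x * value e h x := by
  simp [massForm, weightForm_apply]

theorem dirichletForm_comm (k h : G.SobolevPair) : G.dirichletForm k h = G.dirichletForm h k := by
  simp only [dirichletForm_apply, real_inner_comm]

theorem weightForm_comm (p : E → C(ℝ, ℝ)) (k h : G.SobolevPair) :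
    G.weightForm p k h = G.weightForm p h k := by
  simp only [weightForm_apply, mul_comm (value _ k _)]

theorem weightForm_smul (c : ℝ) (p : E → C(ℝ, ℝ)) : G.weightForm (c • p) = c • G.weightForm p := by
  refine ContinuousLinearMap.ext fun k => ContinuousLinearMap.ext fun h => ?_
  simp [weightForm_apply, Finset.mul_sum, ← intervalIntegral.integral_const_mul, mul_assoc]

theorem weightForm_zero : G.weightForm 0 = 0 :=
  ContinuousLinearMap.ext fun k => ContinuousLinearMap.ext fun h => by simp [weightForm_apply]

theorem dirichletForm_self_nonneg (k : G.SobolevPair) : 0 ≤ G.dirichletForm k k := by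
  rw [dirichletForm_apply]
  exact Finset.sum_nonneg fun _ _ => real_inner_self_nonneg

theorem weightForm_mono {p r : E → C(ℝ, ℝ)} (h : ∀ e, ∀ x ∈ Icc 0 (G.len e), p e x ≤ r e x)
    (k : G.SobolevPair) : G.weightForm p k k ≤ G.weightForm r k k := by
  simp only [weightForm_apply]
  exact Finset.sum_le_sum fun e _ => intervalIntegral.integral_mono_on (G.len_pos e).le
    (Continuous.intervalIntegrable (by fun_prop) _ _)
    (Continuous.intervalIntegrable (by fun_prop) _ _) fun x hx =>
      mul_le_mul_of_nonneg_right (h e x hx) (mul_self_nonneg _)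

theorem massForm_self_nonneg (k : G.SobolevPair) : 0 ≤ G.massForm k k := by
  simpa [weightForm_zero] using weightForm_mono (p := 0) (r := 1) (fun _ _ _ => zero_le_one) k

theorem exists_abs_weightForm_self_le (p : E → C(ℝ, ℝ)) :
    ∃ δ, ∀ k : G.SobolevPair, |G.weightForm p k k| ≤ δ * G.massForm k k := by
  choose C hC using fun e => (isCompact_Icc (a := 0) (b := G.len e)).exists_bound_of_continuousOn
    (p e).continuous.continuousOn
  have hle : ∀ e, ∀ x ∈ Icc 0 (G.len e), |p e x| ≤ ∑ e, |C e| := fun e x hx =>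
    (hC e x hx).trans <| (le_abs_self _).trans <|
      Finset.single_le_sum (f := fun e => |C e|) (fun _ _ => abs_nonneg _) (Finset.mem_univ e)
  refine ⟨∑ e, |C e|, fun k => abs_le.2 ⟨?_, ?_⟩⟩
  · simpa only [weightForm_smul, smul_apply, smul_eq_mul, neg_mul] using
      weightForm_mono (p := (-∑ e, |C e|) • (1 : E → C(ℝ, ℝ))) (r := p)
        (fun e x hx => by simpa using (abs_le.1 (hle e x hx)).1) k
  · simpa only [weightForm_smul, smul_apply, smul_eq_mul, neg_mul] using
      weightForm_mono (p := p) (r := (∑ e, |C e|) • 1)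
        (fun e x hx => by simpa using (abs_le.1 (hle e x hx)).2) k

end Sobolev

end MetricGraph

namespace MetricGraph

section Compactness

open Filter Topology SobolevPair

variable {V E : Type*} {G : MetricGraph V E}

theorem sq_value_le (k : G.SobolevPair) (e : E) {x₀ : ℝ} (hx₀ : x₀ ∈ Icc 0 (G.len e)) :
    value e k x₀ ^ 2 ≤
      (2 / G.len e + 2 * G.len e) * (‖k.2 e‖ ^ 2 + ∫ x in (0 : ℝ)..G.len e, value e k x ^ 2) := by
  have hlen := G.len_pos e
  have hpointwise : ∀ x ∈ Icc 0 (G.len e),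
      value e k x₀ ^ 2 ≤ 2 * value e k x ^ 2 + 2 * (G.len e * ‖k.2 e‖ ^ 2) := fun x hx => by
    have hdiff : (value e k x₀ - value e k x) ^ 2 ≤ G.len e * ‖k.2 e‖ ^ 2 := by
      rw [← sq_abs]
      refine (pow_le_pow_left₀ (abs_nonneg _) (abs_value_sub_value_le k e x₀ x) 2).trans ?_
      rw [mul_pow, Real.sq_sqrt (abs_nonneg _)]
      gcongr
      exact abs_le.2 ⟨by linarith [hx.2, hx₀.1], by linarith [hx.1, hx₀.2]⟩
    nlinarith [sq_nonneg (value e k x₀ - 2 * value e k x)]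
  have hint := intervalIntegral.integral_mono_on (μ := volume) hlen.le
    (continuous_const.intervalIntegrable 0 (G.len e))
    (Continuous.intervalIntegrable (by fun_prop) _ _) hpointwise
  rw [intervalIntegral.integral_const, intervalIntegral.integral_add
    (Continuous.intervalIntegrable (by fun_prop) _ _) (continuous_const.intervalIntegrable _ _),
    intervalIntegral.integral_const, intervalIntegral.integral_const_mul, sub_zero, smul_eq_mul,
    smul_eq_mul] at hint
  have hsq : 0 ≤ ∫ x in (0 : ℝ)..G.len e, value e k x ^ 2 :=
    intervalIntegral.integral_nonneg hlen.le fun _ _ => sq_nonneg _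
  refine le_of_mul_le_mul_left (hint.trans ?_) hlen
  field_simp
  nlinarith [sq_nonneg ‖k.2 e‖, mul_nonneg (sq_nonneg (G.len e)) hsq]

section

variable [Fintype V] [Fintype E]

theorem norm_sq_add_integral_sq_value_le (k : G.SobolevPair) (e : E) :
    ‖k.2 e‖ ^ 2 + ∫ x in (0 : ℝ)..G.len e, value e k x ^ 2 ≤
      G.dirichletForm k k + G.massForm k k := by
  simp only [dirichletForm_apply, massForm_apply, real_inner_self_eq_norm_sq, ← sq]
  exact add_le_add
    (Finset.single_le_sum (f := fun e => ‖k.2 e‖ ^ 2) (fun _ _ => sq_nonneg _) (Finset.mem_univ e))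
    (Finset.single_le_sum (f := fun e => ∫ x in (0 : ℝ)..G.len e, value e k x ^ 2)
      (fun e _ => intervalIntegral.integral_nonneg (G.len_pos e).le fun _ _ => sq_nonneg _)
      (Finset.mem_univ e))

theorem exists_norm_sq_le_dirichletForm_add_massForm (hG : Function.Surjective G.origin) :
    ∃ C > 0, ∀ k ∈ G.sobolevSpace, ‖k‖ ^ 2 ≤ C * (G.dirichletForm k k + G.massForm k k) := by
  have hpos : ∀ e, 0 ≤ 2 / G.len e + 2 * G.len e := fun e => by
    have := G.len_pos e
    positivity
  have hsum : 0 < 1 + ∑ e, (2 / G.len e + 2 * G.len e) := by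
    linarith [Finset.sum_nonneg fun e (_ : e ∈ Finset.univ) => hpos e]
  refine ⟨1 + ∑ e, (2 / G.len e + 2 * G.len e), hsum, fun k hk => ?_⟩
  have henergy : 0 ≤ G.dirichletForm k k + G.massForm k k :=
    add_nonneg (dirichletForm_self_nonneg k) (massForm_self_nonneg k)
  have hvalue : ∀ e, ∀ x ∈ Icc 0 (G.len e), value e k x ^ 2 ≤
      (1 + ∑ e, (2 / G.len e + 2 * G.len e)) * (G.dirichletForm k k + G.massForm k k) :=
    fun e x hx => (sq_value_le k e hx).trans <| by
      have := Finset.single_le_sum (f := fun e => 2 / G.len e + 2 * G.len e)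
        (fun e _ => hpos e) (Finset.mem_univ e)
      exact mul_le_mul (by linarith) (norm_sq_add_integral_sq_value_le k e)
        (add_nonneg (sq_nonneg _) (intervalIntegral.integral_nonneg (G.len_pos e).le
          fun _ _ => sq_nonneg _)) (by linarith [hpos e])
  rw [← Real.le_sqrt (norm_nonneg _), norm_prod_le_iff,
    pi_norm_le_iff_of_nonneg (Real.sqrt_nonneg _), pi_norm_le_iff_of_nonneg (Real.sqrt_nonneg _)]
  · refine ⟨fun v => ?_, fun e => Real.le_sqrt_of_sq_le ?_⟩
    · refine Real.abs_le_sqrt ?_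
      obtain ⟨⟨e, _ | _⟩, rfl⟩ := hG v
      · simpa [origin, hk e] using hvalue e _ (right_mem_Icc.2 (G.len_pos e).le)
      · simpa [origin, value_zero] using hvalue e 0 (left_mem_Icc.2 (G.len_pos e).le)
    · have hsq : 0 ≤ ∫ x in (0 : ℝ)..G.len e, value e k x ^ 2 :=
        intervalIntegral.integral_nonneg (G.len_pos e).le fun _ _ => sq_nonneg _
      nlinarith [norm_sq_add_integral_sq_value_le k e,
        mul_nonneg (Finset.sum_nonneg fun e (_ : e ∈ Finset.univ) => hpos e) henergy]
  · exact mul_nonneg hsum.le henergy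

end

variable [Fintype E]

/-- The restriction to the edges of the function described by `k`, with the supremum norm. -/
noncomputable def SobolevPair.restrict (k : G.SobolevPair) :
    BoundedContinuousFunction (Σ e, Icc (0 : ℝ) (G.len e)) ℝ :=
  BoundedContinuousFunction.mkOfCompact ⟨fun z => value z.1 k z.2,
    continuous_sigma fun e => (value e k).continuous.comp continuous_subtype_val⟩

variable [Fintype V]

theorem isCompact_closure_range_restrict {k : ℕ → G.SobolevPair} {R : ℝ} (hR : ∀ n, ‖k n‖ ≤ R) :
    IsCompact (closure (range fun n => (k n).restrict)) := by
  refine BoundedContinuousFunction.arzela_ascoli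
    (Icc (-((∑ e, (1 + √(G.len e))) * R)) ((∑ e, (1 + √(G.len e))) * R)) isCompact_Icc _ ?_ ?_
  · rintro _ ⟨e, x, hx⟩ ⟨n, rfl⟩
    have hsum := Finset.single_le_sum (f := fun e => 1 + √(G.len e)) (fun e _ => by positivity)
      (Finset.mem_univ e)
    exact abs_le.1 ((abs_value_le (k n) e hx).trans
      (mul_le_mul hsum (hR n) (norm_nonneg _) (by positivity)))
  · rintro ⟨e, x⟩ U hU
    rw [Sigma.nhds_mk, eventually_map]
    have hmodulus : Tendsto (fun y : Icc (0 : ℝ) (G.len e) => √|(x : ℝ) - y| * R) (𝓝 x) (𝓝 0) := by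
      have : Continuous fun y : Icc (0 : ℝ) (G.len e) => √|(x : ℝ) - y| * R := by fun_prop
      simpa using this.tendsto x
    have hequi : EquicontinuousAt (fun (f : range fun n => (k n).restrict)
        (y : Icc (0 : ℝ) (G.len e)) => f.1 ⟨e, y⟩) x := by
      refine Metric.equicontinuousAt_of_continuity_modulus _ hmodulus _ (Eventually.of_forall ?_)
      rintro y ⟨_, n, rfl⟩
      refine (abs_value_sub_value_le (k n) e x y).trans
        (mul_le_mul_of_nonneg_left ?_ (Real.sqrt_nonneg _))
      exact ((norm_le_pi_norm (k n).2 e).trans (norm_snd_le (k n))).trans (hR n)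
    exact hequi U hU

theorem massForm_sub_self_le (k h : G.SobolevPair) :
    G.massForm (k - h) (k - h) ≤ G.totalLength * dist k.restrict h.restrict ^ 2 := by
  rw [massForm_apply, totalLength, Finset.sum_mul]
  refine Finset.sum_le_sum fun e _ => ?_
  have hsq : ∀ x ∈ Icc 0 (G.len e),
      value e (k - h) x * value e (k - h) x ≤ dist k.restrict h.restrict ^ 2 := fun x hx => by
    have hdist : |value e k x - value e h x| ≤ dist k.restrict h.restrict :=
      BoundedContinuousFunction.dist_coe_le_dist (f := k.restrict) (g := h.restrict) ⟨e, ⟨x, hx⟩⟩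
    rw [← sq, ← sq_abs, map_sub, ContinuousMap.sub_apply]
    exact pow_le_pow_left₀ (abs_nonneg _) hdist 2
  have hint := intervalIntegral.integral_mono_on (μ := volume) (G.len_pos e).le
    (Continuous.intervalIntegrable (by fun_prop) _ _)
    (continuous_const.intervalIntegrable 0 (G.len e)) hsq
  rwa [intervalIntegral.integral_const, sub_zero, smul_eq_mul] at hint

theorem exists_subseq_tendsto_massForm_sub (k : ℕ → G.SobolevPair) (R : ℝ)
    (hR : ∀ n, ‖k n‖ ≤ R) : ∃ φ : ℕ → ℕ, StrictMono φ ∧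
      Tendsto (fun p : ℕ × ℕ => G.massForm (k (φ p.1) - k (φ p.2)) (k (φ p.1) - k (φ p.2)))
        atTop (𝓝 0) := by
  obtain ⟨f, -, φ, hφ, hf⟩ := (isCompact_closure_range_restrict hR).tendsto_subseq
    fun n => subset_closure (mem_range_self n)
  have hcauchy := ((cauchySeq_iff_tendsto_dist_atTop_0.1 hf.cauchySeq).pow 2).const_mul
    G.totalLength
  rw [zero_pow two_ne_zero, mul_zero] at hcauchy
  exact ⟨φ, hφ, squeeze_zero (fun _ => massForm_self_nonneg _)
    (fun _ => massForm_sub_self_le _ _) hcauchy⟩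

theorem isRayleighCompact (hG : Function.Surjective G.origin) (p : E → C(ℝ, ℝ)) :
    IsRayleighCompact (G.dirichletForm + G.weightForm p) G.massForm G.sobolevSpace where
  symm_left k h := by simp [dirichletForm_comm k, weightForm_comm p k]
  symm_right := weightForm_comm 1
  nonneg := massForm_self_nonneg
  isClosed := isClosed_sobolevSpace
  garding := by
    obtain ⟨C, hC, hle⟩ := exists_norm_sq_le_dirichletForm_add_massForm hG
    obtain ⟨δ, hδ⟩ := exists_abs_weightForm_self_le (G := G) p
    refine ⟨C, 1 + δ, hC, fun k hk => (hle k hk).trans (mul_le_mul_of_nonneg_left ?_ hC.le)⟩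
    have := (abs_le.1 (hδ k)).1
    simp only [add_apply]
    linarith
  compact := exists_subseq_tendsto_massForm_sub

end Compactness

end MetricGraph

section Primitives

theorem absolutelyContinuousOnInterval_const_add_integral {f : ℝ → ℝ} {a b : ℝ}
    (hf : IntervalIntegrable f volume a b) (c : ℝ) :
    AbsolutelyContinuousOnInterval (fun x => c + ∫ t in a..x, f t) a b :=
  contDiff_const.contDiffOn.absolutelyContinuousOnInterval.add
    (hf.absolutelyContinuousOnInterval_intervalIntegral left_mem_uIcc)

theorem integral_mul_add_mul_of_eq_primitive {f g F G : ℝ → ℝ} {a b : ℝ}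
    (hf : IntervalIntegrable f volume a b) (hg : IntervalIntegrable g volume a b)
    (hF : ∀ x ∈ uIcc a b, F x = F a + ∫ t in a..x, f t)
    (hG : ∀ x ∈ uIcc a b, G x = G a + ∫ t in a..x, g t) :
    ∫ x in a..b, (f x * G x + F x * g x) = F b * G b - F a * G a := by
  have hparts := (absolutelyContinuousOnInterval_const_add_integral hf (F a))
    |>.integral_deriv_mul_eq_sub (absolutelyContinuousOnInterval_const_add_integral hg (G a))
  simp only [← hF b right_mem_uIcc, ← hG b right_mem_uIcc, intervalIntegral.integral_same,
    add_zero] at hparts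
  rw [← hparts]
  refine intervalIntegral.integral_congr_ae ?_
  filter_upwards [hf.ae_hasDerivAt_integral, hg.ae_hasDerivAt_integral] with x hfx hgx hx
  have hx' := uIoc_subset_uIcc hx
  rw [((hfx hx' a left_mem_uIcc).const_add (F a)).deriv,
    ((hgx hx' a left_mem_uIcc).const_add (G a)).deriv, hF x hx', hG x hx']

/-- The du Bois-Reymond lemma. -/
theorem exists_ae_eq_const_of_inner_eq_zero {α : Type*} {m : MeasurableSpace α} {μ : Measure α}
    [IsFiniteMeasure μ] {f : Lp ℝ 2 μ} (hf : ∀ r : Lp ℝ 2 μ, ∫ x, r x ∂μ = 0 → inner ℝ f r = 0) :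
    ∃ c, f =ᵐ[μ] fun _ => c := by
  have hmem : f ∈ (ℝ ∙ Lp.const 2 μ (1 : ℝ))ᗮᗮ := by
    refine (Submodule.mem_orthogonal' _ _).2 fun r hr => hf r ?_
    rw [Submodule.mem_orthogonal_singleton_iff_inner_right, ← indicatorConstLp_univ,
      L2.inner_indicatorConstLp_one, Measure.restrict_univ] at hr
    exact hr
  rw [Submodule.orthogonal_orthogonal, Submodule.mem_span_singleton] at hmem
  obtain ⟨c, rfl⟩ := hmem
  refine ⟨c, ?_⟩
  filter_upwards [Lp.coeFn_smul c (Lp.const 2 μ (1 : ℝ)), Lp.coeFn_const 2 μ (1 : ℝ)] with x hx hx'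
  rw [hx, Pi.smul_apply, hx', Function.const_apply, smul_eq_mul, mul_one]

end Primitives

namespace MetricGraph

section Points

variable {V E : Type*} {G : MetricGraph V E}

theorem pt_of_mem_Ioo {e : E} {x : ℝ} (hx : x ∈ Ioo 0 (G.len e)) :
    G.pt e x = Point.interior e x hx := dif_pos hx

theorem pt_zero (e : E) : G.pt e 0 = Point.vertex (G.src e) := by simp [pt]

theorem pt_len (e : E) : G.pt e (G.len e) = Point.vertex (G.tgt e) := by
  simp [pt, (G.len_pos e).not_ge]

/-- The function described by a pair, evaluated at the points of `G`. -/
noncomputable def SobolevPair.toFun : G.SobolevPair →ₗ[ℝ] G.Point → ℝ where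
  toFun k
    | Point.vertex v => k.1 v
    | Point.interior e x _ => value e k x
  map_add' k h := by ext (v | ⟨e, x, hx⟩) <;> simp
  map_smul' c k := by ext (v | ⟨e, x, hx⟩) <;> simp

/-- `q` is given on every edge `e` by the continuous function `p e`. -/
def EqOnEdges (q : G.Point → ℝ) (p : E → C(ℝ, ℝ)) : Prop :=
  ∀ e, ∀ x ∈ Icc 0 (G.len e), q (G.pt e x) = p e x

open SobolevPair

theorem eqOnEdges_toFun {k : G.SobolevPair} (hk : k ∈ G.sobolevSpace) :
    EqOnEdges (toFun k) fun e => value e k := by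
  intro e x hx
  obtain rfl | h₀ := hx.1.eq_or_lt
  · rw [pt_zero, value_zero]
    rfl
  obtain rfl | h₁ := hx.2.eq_or_lt
  · rw [pt_len, hk e]
    rfl
  · rw [pt_of_mem_Ioo ⟨h₀, h₁⟩]
    rfl

theorem memLp_edgeMeasure {e : E} {f : ℝ → ℝ} (hf : ContinuousOn f (Icc 0 (G.len e))) :
    MemLp f 2 (G.edgeMeasure e) := by
  obtain ⟨C, hC⟩ := isCompact_Icc.exists_bound_of_continuousOn hf
  exact MemLp.of_bound ((hf.mono Ioc_subset_Icc_self).aestronglyMeasurable measurableSet_Ioc) C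
    (ae_restrict_of_forall_mem measurableSet_Ioc fun x hx => hC x (Ioc_subset_Icc_self hx))

theorem value_of_snd_eq_zero {k : G.SobolevPair} {e : E} (hk : k.2 e = 0) (x : ℝ) :
    value e k x = k.1 (G.src e) := by
  rw [value_apply, hk, intervalIntegral.integral_congr_ae
    (g := fun _ => 0) ((Lp.coeFn_zero ℝ 2 _).mono fun _ hy _ => hy), intervalIntegral.integral_zero,
    add_zero]

end Points

section Regularity

open SobolevPair

variable {V E : Type*} {G : MetricGraph V E}

theorem inner_add_integral_mul_value (h : G.SobolevPair) (e : E) {F g : ℝ → ℝ}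
    (hg : Continuous g) (hF : ∀ x ∈ Icc 0 (G.len e), F x = F 0 + ∫ t in (0 : ℝ)..x, g t)
    {f : Lp ℝ 2 (G.edgeMeasure e)} (hf : f =ᵐ[G.edgeMeasure e] F) :
    inner ℝ f (h.2 e) + ∫ x in (0 : ℝ)..G.len e, g x * value e h x =
      F (G.len e) * value e h (G.len e) - F 0 * h.1 (G.src e) := by
  have hlen := (G.len_pos e).le
  have hFcont : ContinuousOn F (uIcc 0 (G.len e)) := by
    rw [uIcc_of_le hlen]
    exact ContinuousOn.congr (Continuous.continuousOn (continuous_const.add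
      (intervalIntegral.continuous_primitive (fun a b => hg.intervalIntegrable a b) 0))) hF
  have hint := intervalIntegrable_volume (h.2 e)
  have hinner : inner ℝ f (h.2 e) = ∫ x in (0 : ℝ)..G.len e, F x * h.2 e x := by
    rw [L2.inner_def, intervalIntegral.integral_of_le hlen]
    refine integral_congr_ae (hf.mono fun x hx => ?_)
    simp only [hx, RCLike.inner_apply, conj_trivial, mul_comm]
  rw [hinner, add_comm, ← intervalIntegral.integral_add
    (Continuous.intervalIntegrable (by fun_prop) _ _) (hint.continuousOn_mul hFcont),
    ← value_zero h e]
  refine integral_mul_add_mul_of_eq_primitive (hg.intervalIntegrable _ _) hint ?_ ?_ <;>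
    rw [uIcc_of_le hlen]
  · exact hF
  · exact fun x hx => by rw [value_zero, value_eq_of_ae_eq (ae_eq_refl _) hx]

theorem value_single_of_ne [DecidableEq E] {e e' : E} (he : e' ≠ e)
    (r : Lp ℝ 2 (G.edgeMeasure e)) (x : ℝ) :
    value e' ((0, Pi.single e r) : G.SobolevPair) x = 0 :=
  value_of_snd_eq_zero (by simp [Pi.single_eq_of_ne he]) x

theorem single_mem_sobolevSpace [DecidableEq E] {e : E} {r : Lp ℝ 2 (G.edgeMeasure e)}
    (hr : ∫ x, r x ∂G.edgeMeasure e = 0) :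
    ((0, Pi.single e r) : G.SobolevPair) ∈ G.sobolevSpace := by
  intro e'
  obtain rfl | he := eq_or_ne e' e
  · simp [value_apply, intervalIntegral_edgeMeasure _ (right_mem_Icc.2 (G.len_pos e').le),
      intervalIntegral.integral_of_le (G.len_pos e').le, hr]
  · exact value_single_of_ne he r _

theorem exists_mem_sobolevSpace_fst_eq (c : V → ℝ) : ∃ h ∈ G.sobolevSpace, h.1 = c := by
  refine ⟨(c, fun e => Lp.const 2 _ ((c (G.tgt e) - c (G.src e)) / G.len e)), fun e => ?_, rfl⟩
  rw [value_eq_of_ae_eq (Lp.coeFn_const _ _ _) (right_mem_Icc.2 (G.len_pos e).le)]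
  simp only [intervalIntegral.integral_const, sub_zero, smul_eq_mul, Function.const_apply,
    mul_div_cancel₀ _ (G.len_pos e).ne', add_sub_cancel]

variable [Fintype V] [Fintype E]

theorem dirichletForm_add_weightForm_sub (p : E → C(ℝ, ℝ)) (μ : ℝ) (k h : G.SobolevPair) :
    (G.dirichletForm + G.weightForm p) k h - μ * G.massForm k h =
      ∑ e, (inner ℝ (k.2 e) (h.2 e) +
        ∫ x in (0 : ℝ)..G.len e, (p e x - μ) * value e k x * value e h x) := by
  rw [massForm_apply]
  simp only [add_apply, dirichletForm_apply, weightForm_apply, Finset.mul_sum,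
    ← Finset.sum_add_distrib, ← Finset.sum_sub_distrib]
  refine Finset.sum_congr rfl fun e _ => ?_
  rw [add_sub_assoc, ← intervalIntegral.integral_const_mul, ← intervalIntegral.integral_sub
    (Continuous.intervalIntegrable (by fun_prop) _ _)
    (Continuous.intervalIntegrable (by fun_prop) _ _)]
  simp only [sub_mul, mul_assoc]

theorem exists_ae_eq_primitive_of_isWeakEigenvector {p : E → C(ℝ, ℝ)} {μ : ℝ} {k : G.SobolevPair}
    (hk : IsWeakEigenvector (G.dirichletForm + G.weightForm p) G.massForm G.sobolevSpace μ k)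
    (e : E) : ∃ c, k.2 e =ᵐ[G.edgeMeasure e]
      fun x => c + ∫ t in (0 : ℝ)..x, (p e t - μ) * value e k t := by
  classical
  set P : ℝ → ℝ := fun x => ∫ t in (0 : ℝ)..x, (p e t - μ) * value e k t with hP
  have hPcont : Continuous P := intervalIntegral.continuous_primitive
    (fun a b => Continuous.intervalIntegrable (by fun_prop) a b) 0
  obtain ⟨f, hf⟩ : ∃ f : Lp ℝ 2 (G.edgeMeasure e), f =ᵐ[G.edgeMeasure e] P :=
    ⟨_, (memLp_edgeMeasure hPcont.continuousOn).coeFn_toLp⟩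
  obtain ⟨c, hc⟩ := exists_ae_eq_const_of_inner_eq_zero (f := k.2 e - f) fun r hr => by
    have htest := single_mem_sobolevSpace hr
    have hparts := inner_add_integral_mul_value (0, Pi.single e r) e
      (g := fun t => (p e t - μ) * value e k t) (by fun_prop) (fun x _ => by simp [hP]) hf
    have hweak := sub_eq_zero.2 (hk.2 _ htest)
    rw [dirichletForm_add_weightForm_sub, Finset.sum_eq_single e (fun e' _ he' => by
      simp [Pi.single_eq_of_ne he', value_single_of_ne he']) (by simp)] at hweak
    rw [htest e] at hparts
    simp only [Pi.single_eq_same, Pi.zero_apply, mul_zero, sub_zero] at hparts hweak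
    rw [inner_sub_left]
    linarith
  refine ⟨c, ?_⟩
  filter_upwards [hc, hf, Lp.coeFn_sub (k.2 e) f] with x hcx hfx hx
  rw [hx, Pi.sub_apply, hfx] at hcx
  linarith

variable [DecidableEq V]

variable (G) in
/-- The sum of the derivatives `F` in the directions of the edges incident to `v`. -/
def kirchhoffSum (F : E → ℝ → ℝ) (v : V) : ℝ :=
  (∑ e with G.src e = v, F e 0) - ∑ e with G.tgt e = v, F e (G.len e)

theorem sum_edges_eq_neg_sum_kirchhoffSum (F : E → ℝ → ℝ) (c : V → ℝ) :
    ∑ e, (F e (G.len e) * c (G.tgt e) - F e 0 * c (G.src e)) =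
      -∑ v, c v * G.kirchhoffSum F v := by
  have hfiber : ∀ (f : E → V) (A : E → ℝ),
      ∑ e, A e * c (f e) = ∑ v, c v * ∑ e with f e = v, A e := fun f A => by
    rw [← Finset.sum_fiberwise (Finset.univ : Finset E) f]
    refine Finset.sum_congr rfl fun v _ => ?_
    rw [Finset.mul_sum]
    exact Finset.sum_congr rfl fun e he => by rw [(Finset.mem_filter.1 he).2, mul_comm]
  simp only [Finset.sum_sub_distrib, hfiber, kirchhoffSum, mul_sub, neg_sub]

theorem dirichletForm_add_weightForm_sub_eq_sum_kirchhoffSum {p : E → C(ℝ, ℝ)} {μ : ℝ}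
    {k h : G.SobolevPair} (hh : h ∈ G.sobolevSpace) {F : E → ℝ → ℝ}
    (hk : ∀ e, k.2 e =ᵐ[G.edgeMeasure e] F e) (hF : ∀ e, ∀ x ∈ Icc 0 (G.len e),
      F e x = F e 0 + ∫ t in (0 : ℝ)..x, (p e t - μ) * value e k t) :
    (G.dirichletForm + G.weightForm p) k h - μ * G.massForm k h =
      -∑ v, h.1 v * G.kirchhoffSum F v := by
  rw [dirichletForm_add_weightForm_sub, ← sum_edges_eq_neg_sum_kirchhoffSum]
  refine Finset.sum_congr rfl fun e _ => ?_
  rw [inner_add_integral_mul_value h e (by fun_prop) (hF e) (hk e), hh e]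

theorem isWeakEigenvector_iff {p : E → C(ℝ, ℝ)} {μ : ℝ} {k : G.SobolevPair} :
    IsWeakEigenvector (G.dirichletForm + G.weightForm p) G.massForm G.sobolevSpace μ k ↔
      k ∈ G.sobolevSpace ∧ ∃ F : E → ℝ → ℝ, (∀ e, k.2 e =ᵐ[G.edgeMeasure e] F e) ∧
        (∀ e, ∀ x ∈ Icc 0 (G.len e),
          F e x = F e 0 + ∫ t in (0 : ℝ)..x, (p e t - μ) * value e k t) ∧
        ∀ v, G.kirchhoffSum F v = 0 := by
  refine ⟨fun hk => ⟨hk.1, ?_⟩, fun ⟨hkK, F, hkF, hF, hsum⟩ => ⟨hkK, fun h hh => ?_⟩⟩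
  · choose c hc using fun e => exists_ae_eq_primitive_of_isWeakEigenvector hk e
    refine ⟨_, hc, fun e x _ => by simp, fun v => ?_⟩
    obtain ⟨h, hh, hhv⟩ := exists_mem_sobolevSpace_fst_eq (G := G) (Pi.single v 1)
    have hgreen := dirichletForm_add_weightForm_sub_eq_sum_kirchhoffSum (p := p) (μ := μ) hh hc
      fun e x _ => by simp
    rw [hk.2 h hh, sub_self, hhv] at hgreen
    simpa [Pi.single_apply] using hgreen.symm
  · rw [← sub_eq_zero, dirichletForm_add_weightForm_sub_eq_sum_kirchhoffSum hh hkF hF]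
    simp [hsum]

end Regularity

end MetricGraph

namespace MetricGraph

open SobolevPair Filter Topology Module

variable {V E : Type*} {G : MetricGraph V E}

section EqOnEdges

variable {q : G.Point → ℝ} {p : E → C(ℝ, ℝ)}

theorem eqOnEdges_zero : EqOnEdges (0 : G.Point → ℝ) 0 :=
  fun _ _ _ => rfl

theorem EqOnEdges.smul (hqp : EqOnEdges q p) (s : ℝ) : EqOnEdges (s • q) (s • p) :=
  fun e x hx => congrArg (s • ·) (hqp e x hx)

end EqOnEdges

section Correspondence

variable [DecidableEq V] [Fintype E] {q u : G.Point → ℝ} {p : E → C(ℝ, ℝ)}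
  {du ddu : E → ℝ → ℝ} {ν : ℝ}

theorem InDomain.intervalIntegrable (h : G.InDomain u du ddu) (e : E) :
    IntervalIntegrable (ddu e) volume 0 (G.len e) :=
  (intervalIntegrable_iff_integrableOn_Ioo_of_le (G.len_pos e).le).2
    ((h.memLp e).integrable one_le_two)

theorem InDomain.continuousOn (h : G.InDomain u du ddu) (e : E) :
    ContinuousOn (du e) (Icc 0 (G.len e)) := by
  have hprim := intervalIntegral.continuousOn_primitive_interval' (h.intervalIntegrable e)
    left_mem_uIcc
  rw [uIcc_of_le (G.len_pos e).le] at hprim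
  exact (continuousOn_const.add hprim).congr (h.primitive e)

theorem InDomain.eq_add_integral (h : G.InDomain u du ddu) (e : E) {x : ℝ}
    (hx : x ∈ Icc 0 (G.len e)) :
    u (G.pt e x) = u (Point.vertex (G.src e)) + ∫ y in (0 : ℝ)..x, du e y := by
  have hsub : Icc 0 x ⊆ Icc 0 (G.len e) := Icc_subset_Icc_right hx.2
  rw [← pt_zero, intervalIntegral.integral_eq_sub_of_hasDerivAt_of_le (f := fun y => u (G.pt e y))
    hx.1 (fun y hy => ((h.hasDeriv e y (hsub hy)).mono hsub).continuousWithinAt)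
    (fun y hy => (h.hasDeriv e y (hsub (Ioo_subset_Icc_self hy))).hasDerivAt
      (Icc_mem_nhds hy.1 (hy.2.trans_le hx.2)))
    (((h.continuousOn e).mono hsub).intervalIntegrable_of_Icc hx.1), add_sub_cancel]

theorem InDomain.exists_sobolevPair (h : G.InDomain u du ddu) :
    ∃ k ∈ G.sobolevSpace, toFun k = u ∧ ∀ e, k.2 e =ᵐ[G.edgeMeasure e] du e := by
  let k : G.SobolevPair := (fun v => u (Point.vertex v),
    fun e => (memLp_edgeMeasure (h.continuousOn e)).toLp (du e))
  have hk : ∀ e, k.2 e =ᵐ[G.edgeMeasure e] du e := fun e =>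
    (memLp_edgeMeasure (h.continuousOn e)).coeFn_toLp
  have hvalue : ∀ e, ∀ x ∈ Icc 0 (G.len e), value e k x = u (G.pt e x) := fun e x hx => by
    rw [value_eq_of_ae_eq (hk e) hx, h.eq_add_integral e hx]
  have hkK : k ∈ G.sobolevSpace := fun e => by
    rw [hvalue e _ (right_mem_Icc.2 (G.len_pos e).le), pt_len]
  refine ⟨k, hkK, funext ?_, hk⟩
  rintro (v | ⟨e, x, hx⟩)
  · rfl
  · have hxI := Ioo_subset_Icc_self hx
    rw [← pt_of_mem_Ioo hx, eqOnEdges_toFun hkK e x hxI, hvalue e x hxI]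

variable [Fintype V]

theorem IsEigenfunction.exists_isWeakEigenvector (hu : G.IsEigenfunction q ν u)
    (hqp : EqOnEdges q p) :
    ∃ k, IsWeakEigenvector (G.dirichletForm + G.weightForm p) G.massForm G.sobolevSpace ν k ∧
      toFun k = u := by
  obtain ⟨-, du, ddu, hdom, heq⟩ := hu
  obtain ⟨k, hk, rfl, hdu⟩ := hdom.exists_sobolevPair
  refine ⟨k, isWeakEigenvector_iff.2 ⟨hk, du, hdu, fun e x hx => ?_, hdom.kirchhoff⟩, rfl⟩
  rw [hdom.primitive e x hx, intervalIntegral.integral_of_le hx.1,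
    intervalIntegral.integral_of_le hx.1, integral_Ioc_eq_integral_Ioo,
    integral_Ioc_eq_integral_Ioo]
  refine congrArg _ (integral_congr_ae ?_)
  filter_upwards [ae_restrict_of_ae_restrict_of_subset (Ioo_subset_Ioo_right hx.2) (heq e),
    ae_restrict_mem measurableSet_Ioo] with t ht htx
  have htI : t ∈ Icc 0 (G.len e) := ⟨htx.1.le, htx.2.le.trans hx.2⟩
  rw [hqp e t htI, eqOnEdges_toFun hk e t htI] at ht
  linarith

theorem isEigenfunction_toFun {k : G.SobolevPair}
    (hk : IsWeakEigenvector (G.dirichletForm + G.weightForm p) G.massForm G.sobolevSpace ν k)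
    (hk0 : toFun k ≠ 0) (hqp : EqOnEdges q p) : G.IsEigenfunction q ν (toFun k) := by
  obtain ⟨hkK, F, hkF, hF, hsum⟩ := isWeakEigenvector_iff.1 hk
  have hu := eqOnEdges_toFun hkK
  have hcont : ∀ e, Continuous fun t => (p e t - ν) * value e k t := fun e => by fun_prop
  have hFcont : ∀ e, ContinuousOn (F e) (Icc 0 (G.len e)) := fun e =>
    ((continuous_const.add (intervalIntegral.continuous_primitive
      (fun a b => (hcont e).intervalIntegrable a b) 0)).continuousOn).congr (hF e)
  refine ⟨hk0, F, fun e t => (p e t - ν) * value e k t,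
    ⟨fun e x hx => ?_, fun e => ?_, hF, hsum⟩, fun e => ?_⟩
  · refine HasDerivWithinAt.congr_of_mem (f := fun y => k.1 (G.src e) + ∫ t in (0 : ℝ)..y, F e t)
      ?_ (fun y hy => by rw [hu e y hy, value_eq_of_ae_eq (hkF e) hy]) hx
    have : Fact (x ∈ Icc 0 (G.len e)) := ⟨hx⟩
    exact (intervalIntegral.integral_hasDerivWithinAt_right (t := Icc 0 (G.len e))
      (((hFcont e).mono (Icc_subset_Icc_right hx.2)).intervalIntegrable_of_Icc hx.1)
      ((hFcont e).stronglyMeasurableAtFilter_nhdsWithin measurableSet_Icc x)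
      (hFcont e x hx)).const_add _
  · exact (memLp_edgeMeasure (hcont e).continuousOn).mono_measure
      (Measure.restrict_mono Ioo_subset_Ioc_self le_rfl)
  · refine ae_restrict_of_forall_mem measurableSet_Ioo fun x hx => ?_
    have hxI := Ioo_subset_Icc_self hx
    rw [hqp e x hxI, hu e x hxI]
    ring

end Correspondence

section Constants

variable (G) in
/-- The constant function `1`, which is the ground state of the Laplacian. -/
noncomputable def onePair : G.SobolevPair := (1, 0)

theorem value_onePair (e : E) (x : ℝ) : value e G.onePair x = 1 :=
  value_of_snd_eq_zero rfl x

theorem onePair_mem_sobolevSpace : G.onePair ∈ G.sobolevSpace := fun e => value_onePair e _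

variable [Fintype E]

theorem totalLength_pos [Nonempty E] : 0 < G.totalLength :=
  Finset.sum_pos (fun e _ => G.len_pos e) Finset.univ_nonempty

variable [Fintype V]

theorem dirichletForm_onePair_left (h : G.SobolevPair) : G.dirichletForm G.onePair h = 0 := by
  rw [dirichletForm_apply]
  exact Finset.sum_eq_zero fun e _ => inner_zero_left _

theorem dirichletForm_add_weightForm_zero_apply (k h : G.SobolevPair) :
    (G.dirichletForm + G.weightForm 0) k h = G.dirichletForm k h := by
  rw [add_apply, add_apply, weightForm_zero]
  exact add_zero _

theorem massForm_onePair_eq_zero {k : G.SobolevPair} {μ : ℝ} (hμ : μ ≠ 0)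
    (hk : IsWeakEigenvector (G.dirichletForm + G.weightForm 0) G.massForm G.sobolevSpace μ k) :
    G.massForm G.onePair k = 0 := by
  have hone := hk.2 _ onePair_mem_sobolevSpace
  rw [dirichletForm_add_weightForm_zero_apply, dirichletForm_comm, dirichletForm_onePair_left,
    weightForm_comm] at hone
  exact (mul_eq_zero.1 hone.symm).resolve_left hμ

theorem weightForm_onePair_self (p : E → C(ℝ, ℝ)) :
    G.weightForm p G.onePair G.onePair = ∑ e, ∫ x in (0 : ℝ)..G.len e, p e x := by
  simp only [weightForm_apply, value_onePair, mul_one]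

theorem massForm_onePair_self : G.massForm G.onePair G.onePair = G.totalLength := by
  simp [massForm, weightForm_onePair_self, totalLength]

theorem massForm_onePair_self_pos [Nonempty E] : 0 < G.massForm G.onePair G.onePair :=
  massForm_onePair_self (G := G) ▸ totalLength_pos

theorem massForm_eq_zero_of_toFun_eq_zero {k : G.SobolevPair} (hk : k ∈ G.sobolevSpace)
    (hk0 : toFun k = 0) (h : G.SobolevPair) : G.massForm k h = 0 := by
  rw [massForm_apply]
  refine Finset.sum_eq_zero fun e _ => ?_
  rw [intervalIntegral.integral_congr (g := fun _ => 0) fun x hx => ?_,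
    intervalIntegral.integral_zero]
  rw [uIcc_of_le (G.len_pos e).le] at hx
  simp [← eqOnEdges_toFun hk e x hx, hk0]

theorem integral_toFun_sq {k : G.SobolevPair} (hk : k ∈ G.sobolevSpace) :
    G.integral (fun x => toFun k x ^ 2) = G.massForm k k := by
  rw [massForm_apply, integral]
  refine Finset.sum_congr rfl fun e _ => intervalIntegral.integral_congr fun x hx => ?_
  rw [uIcc_of_le (G.len_pos e).le] at hx
  simp only [eqOnEdges_toFun hk e x hx, sq]

theorem linearIndependent_toFun {ι : Type*} [DecidableEq ι] {k : ι → G.SobolevPair}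
    (hk : ∀ i, k i ∈ G.sobolevSpace)
    (horth : ∀ i j, G.massForm (k i) (k j) = if i = j then 1 else 0) :
    LinearIndependent ℝ fun i => toFun (k i) := by
  refine linearIndependent_iff'.2 fun t c hc j hj => ?_
  simp only [← map_smul, ← map_sum] at hc
  have hzero := massForm_eq_zero_of_toFun_eq_zero
    (Submodule.sum_mem _ fun i _ => Submodule.smul_mem _ (c i) (hk i)) hc (k j)
  simpa [horth, FunLike.coe_sum, Finset.sum_apply, hj] using hzero

end Constants

section Eigenvalues

variable [DecidableEq V] [Fintype E] {q : G.Point → ℝ} {p : E → C(ℝ, ℝ)} {n : ℕ}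

variable (G) in
/-- There are `n` linearly independent eigenfunctions of `-Δ + q` with eigenvalues at most `μ`;
the `n`-th eigenvalue is the infimum of these `μ`. -/
def HasEigenfunctionsBelow (q : G.Point → ℝ) (n : ℕ) (μ : ℝ) : Prop :=
  ∃ w : Fin n → G.Point → ℝ, LinearIndependent ℝ w ∧ ∀ i, ∃ ν ≤ μ, G.IsEigenfunction q ν (w i)

variable [Fintype V] (hG : Function.Surjective G.origin) (hqp : EqOnEdges q p)

include hG hqp

theorem le_of_hasEigenfunctionsBelow [NeZero n] {c μ : ℝ}
    (hc : ∀ k ∈ G.sobolevSpace, c * G.massForm k k ≤ (G.dirichletForm + G.weightForm p) k k)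
    (h : G.HasEigenfunctionsBelow q n μ) : c ≤ μ := by
  obtain ⟨w, -, hw⟩ := h
  obtain ⟨ν, hν, hu⟩ := hw 0
  obtain ⟨k, hk, hku⟩ := hu.exists_isWeakEigenvector hqp
  refine ((isRayleighCompact hG p).le_of_isWeakEigenvector hc hk ?_).trans hν
  rintro rfl
  exact hu.1 (hku ▸ map_zero toFun)

omit [Fintype V] in
theorem integral_sq_pos {ν : ℝ} {u : G.Point → ℝ} (hu : G.IsEigenfunction q ν u) :
    0 < G.integral fun x => u x ^ 2 := by
  have := Fintype.ofSurjective G.origin hG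
  obtain ⟨k, hk, rfl⟩ := hu.exists_isWeakEigenvector hqp
  rw [integral_toFun_sq hk.1]
  refine (isRayleighCompact hG p).self_pos_of_isWeakEigenvector hk ?_
  rintro rfl
  exact hu.1 (map_zero toFun)

theorem hasEigenfunctionsBelow_of_form_le {Λ : ℝ} {F : Submodule ℝ G.SobolevPair}
    (hFK : F ≤ G.sobolevSpace) (hF : n ≤ finrank ℝ F)
    (hpos : ∀ k ∈ F, k ≠ 0 → 0 < G.massForm k k)
    (hle : ∀ k ∈ F, (G.dirichletForm + G.weightForm p) k k ≤ Λ * G.massForm k k) :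
    G.HasEigenfunctionsBelow q n Λ := by
  obtain ⟨k, hk, horth⟩ :=
    (isRayleighCompact hG p).exists_orthonormal_eigenvectors hFK hF hpos hle
  have hmem : ∀ i, k i ∈ G.sobolevSpace := fun i => let ⟨_, _, hki⟩ := hk i; hki.1
  refine ⟨fun i => toFun (k i), linearIndependent_toFun hmem horth, fun i => ?_⟩
  obtain ⟨ν, hν, hki⟩ := hk i
  refine ⟨ν, hν, isEigenfunction_toFun hki (fun h0 => ?_) hqp⟩
  have hone := horth i i
  rw [massForm_eq_zero_of_toFun_eq_zero hki.1 h0, if_pos rfl] at hone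
  exact zero_ne_one hone

theorem hasEigenfunctionsBelow_one {Λ : ℝ} {k : G.SobolevPair} (hk : k ∈ G.sobolevSpace)
    (hpos : 0 < G.massForm k k)
    (hle : (G.dirichletForm + G.weightForm p) k k ≤ Λ * G.massForm k k) :
    G.HasEigenfunctionsBelow q 1 Λ := by
  have hk0 : k ≠ 0 := by
    rintro rfl
    simp at hpos
  refine hasEigenfunctionsBelow_of_form_le hG hqp (F := ℝ ∙ k)
    ((Submodule.span_singleton_le_iff_mem k _).2 hk) (finrank_span_singleton hk0).ge ?_ ?_ <;>
    intro x hx <;> obtain ⟨c, rfl⟩ := Submodule.mem_span_singleton.1 hx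
  · intro hck
    have hc : c ≠ 0 := by
      rintro rfl
      simp at hck
    simp only [map_smul, smul_apply, smul_eq_mul, ← mul_assoc]
    exact mul_pos (mul_self_pos.2 hc) hpos
  · have := mul_le_mul_of_nonneg_left hle (sq_nonneg c)
    simp only [map_smul, smul_apply, smul_eq_mul]
    linarith

theorem hasEigenfunctionsBelow_two {Λ : ℝ} {k h : G.SobolevPair} (hk : k ∈ G.sobolevSpace)
    (hh : h ∈ G.sobolevSpace) (hkpos : 0 < G.massForm k k) (hhpos : 0 < G.massForm h h)
    (horth : G.massForm k h = 0) (hle : ∀ x ∈ Submodule.span ℝ {k, h},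
      (G.dirichletForm + G.weightForm p) x x ≤ Λ * G.massForm x x) :
    G.HasEigenfunctionsBelow q 2 Λ :=
  hasEigenfunctionsBelow_of_form_le hG hqp
    (Submodule.span_le.2 (insert_subset hk (singleton_subset_iff.2 hh)))
    (finrank_span_pair_of_form_eq_zero (weightForm_comm 1) hkpos hhpos horth).ge
    (fun _ => form_self_pos_of_mem_span_pair (weightForm_comm 1) hkpos hhpos horth) hle

omit [Fintype V] in
theorem eigenvalue_le_of_hasEigenfunctionsBelow [NeZero n] {Λ : ℝ}
    (h : G.HasEigenfunctionsBelow q n Λ) : G.eigenvalue q n ≤ Λ :=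
  have := Fintype.ofSurjective G.origin hG
  let ⟨_, hγ⟩ := (isRayleighCompact hG p).exists_lower_bound
  csInf_le ⟨_, fun _ => le_of_hasEigenfunctionsBelow hG hqp hγ⟩ h

omit [Fintype V] hqp in
theorem eigenvalue_zero_one_nonpos [Nonempty E] : G.eigenvalue 0 1 ≤ 0 :=
  have := Fintype.ofSurjective G.origin hG
  eigenvalue_le_of_hasEigenfunctionsBelow hG eqOnEdges_zero <|
    hasEigenfunctionsBelow_one hG eqOnEdges_zero onePair_mem_sobolevSpace
      massForm_onePair_self_pos
      (by rw [dirichletForm_add_weightForm_zero_apply, dirichletForm_onePair_left, zero_mul])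

omit hqp in
theorem eigenvalue_zero_two_mul_massForm_le [Nonempty E] {k : G.SobolevPair}
    (hk : k ∈ G.sobolevSpace) (horth : G.massForm G.onePair k = 0) :
    G.eigenvalue 0 2 * G.massForm k k ≤ G.dirichletForm k k := by
  obtain hk0 | hkpos := (massForm_self_nonneg k).eq_or_lt
  · rw [← hk0, mul_zero]
    exact dirichletForm_self_nonneg k
  rw [← le_div_iff₀ hkpos]
  refine eigenvalue_le_of_hasEigenfunctionsBelow hG eqOnEdges_zero <|
    hasEigenfunctionsBelow_two hG eqOnEdges_zero onePair_mem_sobolevSpace hk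
      massForm_onePair_self_pos hkpos horth fun x hx => ?_
  obtain ⟨s, t, rfl⟩ := Submodule.mem_span_pair.1 hx
  rw [dirichletForm_add_weightForm_zero_apply, form_smul_add_smul dirichletForm_comm,
    form_smul_add_smul (weightForm_comm 1), horth, dirichletForm_onePair_left,
    dirichletForm_onePair_left]
  have hcancel : G.dirichletForm k k / G.massForm k k * (t ^ 2 * G.massForm k k) =
      t ^ 2 * G.dirichletForm k k := by
    rw [mul_left_comm, div_mul_cancel₀ _ hkpos.ne']
  have hone : 0 ≤ G.dirichletForm k k / G.massForm k k *
      (s ^ 2 * G.massForm G.onePair G.onePair) :=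
    mul_nonneg (div_nonneg (dirichletForm_self_nonneg k) hkpos.le)
      (mul_nonneg (sq_nonneg s) (massForm_self_nonneg _))
  linarith

end Eigenvalues

section Gap

variable [Fintype V] [DecidableEq V] [Fintype E] [Nonempty E] {q : G.Point → ℝ}
  {p : E → C(ℝ, ℝ)} {k : G.SobolevPair}

theorem eventually_eigenvalue_two_smul_le (hG : Function.Surjective G.origin)
    (hqp : EqOnEdges q p) {lam : ℝ} (hlam : 0 < lam)
    (hk : IsWeakEigenvector (G.dirichletForm + G.weightForm 0) G.massForm G.sobolevSpace lam k)
    (hkpos : 0 < G.massForm k k) {c : ℝ} (hc : G.weightForm p k k < c * G.massForm k k) :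
    ∀ᶠ s : ℝ in 𝓝[>] 0, G.eigenvalue (s • q) 2 ≤ lam + s * c := by
  obtain ⟨δ, hδ⟩ := exists_abs_weightForm_self_le (G := G) p
  have horth := massForm_onePair_eq_zero hlam.ne' hk
  have hDk : G.dirichletForm k k = lam * G.massForm k k := by
    simpa only [dirichletForm_add_weightForm_zero_apply] using hk.2 k hk.1
  filter_upwards [eventually_form_add_smul_le_on_span_pair (weightForm_comm 1) dirichletForm_comm
    (weightForm_comm p) hδ massForm_onePair_self_pos hkpos horth dirichletForm_onePair_left hlam
    hDk hc] with s hs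
  refine eigenvalue_le_of_hasEigenfunctionsBelow hG (hqp.smul s) <|
    hasEigenfunctionsBelow_two hG (hqp.smul s) onePair_mem_sobolevSpace hk.1
      massForm_onePair_self_pos hkpos horth fun x hx => ?_
  simpa only [weightForm_smul, add_apply, smul_apply, smul_eq_mul] using hs x hx

omit [Fintype V] in
theorem eventually_le_eigenvalue_one_smul (hG : Function.Surjective G.origin)
    (hqp : EqOnEdges q p) (hlam : 0 < G.eigenvalue 0 2) {a : ℝ}
    (ha : a * G.totalLength < ∑ e, ∫ x in (0 : ℝ)..G.len e, p e x) :
    ∀ᶠ s : ℝ in 𝓝[>] 0, s * a ≤ G.eigenvalue (s • q) 1 := by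
  have := Fintype.ofSurjective G.origin hG
  obtain ⟨δ, hδ⟩ := exists_abs_weightForm_self_le (G := G) p
  rw [← massForm_onePair_self, ← weightForm_onePair_self] at ha
  filter_upwards [eventually_mul_form_le_form_add_smul (weightForm_comm 1) dirichletForm_comm
    (weightForm_comm p) massForm_self_nonneg hδ onePair_mem_sobolevSpace massForm_onePair_self_pos
    dirichletForm_onePair_left hlam (fun z => eigenvalue_zero_two_mul_massForm_le hG) ha] with s hs
  refine le_csInf ⟨_, hasEigenfunctionsBelow_one hG (hqp.smul s) onePair_mem_sobolevSpace
    massForm_onePair_self_pos (div_mul_cancel₀ _ massForm_onePair_self_pos.ne').ge⟩ fun μ hμ => ?_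
  refine le_of_hasEigenfunctionsBelow hG (hqp.smul s) (fun x hx => ?_) hμ
  simpa only [weightForm_smul, add_apply, smul_apply, smul_eq_mul] using hs x hx

theorem eventually_gap_smul_lt (hG : Function.Surjective G.origin) (hqp : EqOnEdges q p)
    (hlam : 0 < G.eigenvalue 0 2) (hk : IsWeakEigenvector (G.dirichletForm + G.weightForm 0)
      G.massForm G.sobolevSpace (G.eigenvalue 0 2) k) (hkpos : 0 < G.massForm k k)
    (hlt : G.weightForm p k k / G.massForm k k <
      (∑ e, ∫ x in (0 : ℝ)..G.len e, p e x) / G.totalLength) :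
    ∀ᶠ s : ℝ in 𝓝[>] 0, G.gap (s • q) < G.gap 0 := by
  obtain ⟨c, hc, hca⟩ := exists_between hlt
  obtain ⟨a, hca, ha⟩ := exists_between hca
  filter_upwards [self_mem_nhdsWithin,
    eventually_eigenvalue_two_smul_le hG hqp hlam hk hkpos ((div_lt_iff₀ hkpos).1 hc),
    eventually_le_eigenvalue_one_smul hG hqp hlam ((lt_div_iff₀ totalLength_pos).1 ha)]
    with s hs hupper hlower
  have hground := eigenvalue_zero_one_nonpos hG
  have hsca := mul_lt_mul_of_pos_left hca hs
  simp only [gap]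
  linarith

end Gap

end MetricGraph

namespace MetricGraph

variable {V E : Type*} {G : MetricGraph V E}

section Connected

theorem exists_origin_terminus_of_adj {a b : V} (h : G.toSimpleGraph.Adj a b) :
    ∃ d, G.origin d = a ∧ G.terminus d = b := by
  obtain ⟨-, ⟨e, ha, hb⟩ | ⟨e, hb, ha⟩⟩ := (SimpleGraph.fromRel_adj _ _ _).1 h
  · exact ⟨(e, true), ha, hb⟩
  · exact ⟨(e, false), ha, hb⟩

theorem surjective_origin [Nonempty E] (hG : G.toSimpleGraph.Connected) :
    Function.Surjective G.origin := by
  intro v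
  obtain ⟨e⟩ := ‹Nonempty E›
  obtain ⟨_ | ⟨hadj, _⟩⟩ := hG.preconnected v (G.src e)
  · exact ⟨(e, true), rfl⟩
  · obtain ⟨d, hd, -⟩ := exists_origin_terminus_of_adj hadj
    exact ⟨d, hd⟩

end Connected

section OrientedEdges

theorem origin_not (d : E × Bool) : G.origin (d.1, !d.2) = G.terminus d := by
  rcases d with ⟨e, _ | _⟩ <;> rfl

theorem terminus_not (d : E × Bool) : G.terminus (d.1, !d.2) = G.origin d := by
  rcases d with ⟨e, _ | _⟩ <;> rfl

theorem eq_or_eq_not_of_fst_eq {d d₀ : E × Bool} (h : d.1 = d₀.1) :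
    d = d₀ ∨ d = (d₀.1, !d₀.2) := by
  obtain h₂ | h₂ := eq_or_ne d.2 d₀.2
  · exact .inl (Prod.ext h h₂)
  · exact .inr (Prod.ext h (Bool.eq_not_of_ne h₂))

theorem fst_ne_of_origin_ne_of_terminus_ne {d d₀ : E × Bool} (ho : G.origin d ≠ G.origin d₀)
    (ht : G.terminus d ≠ G.origin d₀) : d.1 ≠ d₀.1 := fun h => by
  obtain rfl | rfl := eq_or_eq_not_of_fst_eq h
  · exact ho rfl
  · exact ht (terminus_not d₀)

variable (G) in
/-- The coordinate on an oriented edge of the point at distance `t` from its origin. -/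
def coord (d : E × Bool) (t : ℝ) : ℝ := if d.2 then t else G.len d.1 - t

theorem coord_coord (d : E × Bool) (t : ℝ) : G.coord d (G.coord d t) = t := by
  unfold coord
  split_ifs <;> ring

theorem coord_not (d : E × Bool) (t : ℝ) :
    G.coord (d.1, !d.2) t = G.coord d (G.len d.1 - t) := by
  rcases d with ⟨e, _ | _⟩ <;> simp [coord]

theorem coord_mem_Icc {d : E × Bool} {t : ℝ} (ht : t ∈ Icc 0 (G.len d.1)) :
    G.coord d t ∈ Icc 0 (G.len d.1) := by
  unfold coord
  split_ifs
  · exact ht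
  · exact ⟨sub_nonneg.2 ht.2, sub_le_self _ ht.1⟩

@[fun_prop]
theorem continuous_coord (d : E × Bool) : Continuous (G.coord d) := by
  unfold coord
  split_ifs <;> fun_prop

theorem pt_coord_zero (d : E × Bool) : G.pt d.1 (G.coord d 0) = Point.vertex (G.origin d) := by
  rcases d with ⟨e, _ | _⟩
  · simpa [coord, origin] using pt_len e
  · simpa [coord, origin] using pt_zero e

theorem trace_cons_of_le (a : V) (d : E × Bool) (l : List (E × Bool)) {t : ℝ}
    (ht : t ≤ G.len d.1) : G.trace a (d :: l) t = G.pt d.1 (G.coord d t) :=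
  if_pos ht

theorem trace_cons_of_lt (a : V) (d : E × Bool) (l : List (E × Bool)) {t : ℝ}
    (ht : G.len d.1 < t) : G.trace a (d :: l) t = G.trace (G.terminus d) l (t - G.len d.1) :=
  if_neg ht.not_ge

theorem pathLength_cons (d : E × Bool) (l : List (E × Bool)) :
    G.pathLength (d :: l) = G.len d.1 + G.pathLength l := rfl

theorem pathLength_nonneg (l : List (E × Bool)) : 0 ≤ G.pathLength l :=
  List.sum_nonneg fun _ hx => by
    obtain ⟨d, -, rfl⟩ := List.mem_map.1 hx
    exact (G.len_pos d.1).le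

end OrientedEdges

section Pendant

variable (G) in
/-- `d` is the only oriented edge with its origin: it is the edge of a leaf, traversed away from
the leaf. -/
def IsPendant (d : E × Bool) : Prop := ∀ d', G.origin d' = G.origin d → d' = d

theorem degree_eq_card_filter_origin [DecidableEq V] [Fintype E] (v : V) :
    G.degree v = (Finset.univ.filter fun d => G.origin d = v).card := by
  simp only [degree, Finset.card_filter, Fintype.sum_prod_type, Fintype.sum_bool,
    Finset.sum_add_distrib]
  rfl

theorem IsLeaf.exists_isPendant [DecidableEq V] [Fintype E] {v : V} (hv : G.IsLeaf v) :
    ∃ d, G.origin d = v ∧ G.IsPendant d := by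
  rw [IsLeaf, degree_eq_card_filter_origin, Finset.card_eq_one] at hv
  obtain ⟨d, hd⟩ := hv
  have hmem : ∀ d', G.origin d' = v ↔ d' = d := fun d' => by simpa using Finset.ext_iff.1 hd d'
  obtain rfl := (hmem d).2 rfl
  exact ⟨d, rfl, fun d' => (hmem d').1⟩

variable {d d₀ : E × Bool} {a b : V} {l : List (E × Bool)}

namespace IsPendant

theorem eq_not_of_terminus_eq (hd₀ : G.IsPendant d₀) (h : G.terminus d = G.origin d₀) :
    d = (d₀.1, !d₀.2) := by
  have hnot := hd₀ (d.1, !d.2) (by rw [origin_not, h])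
  rw [← hnot, Bool.not_not]

theorem terminus_ne_origin (hd₀ : G.IsPendant d₀) : G.terminus d₀ ≠ G.origin d₀ := fun h =>
  Bool.not_ne_self d₀.2 (congrArg Prod.snd (hd₀.eq_not_of_terminus_eq h)).symm

theorem eq_nil_of_isPath_cons (hd₀ : G.IsPendant d₀) (hl : G.IsPath a (d :: l) b)
    (hd : G.terminus d = G.origin d₀) : l = [] := by
  obtain ⟨⟨rfl, hwalk⟩, hnodup⟩ := hl
  cases l with
  | nil => rfl
  | cons d' l =>
    obtain rfl := hd₀ d' (hwalk.1.trans hd)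
    refine absurd ?_ (List.nodup_cons.1 hnodup).1
    rw [hd₀.eq_not_of_terminus_eq hd, origin_not]
    exact List.mem_cons_of_mem _ List.mem_cons_self

theorem len_le_pathLength (hd₀ : G.IsPendant d₀) (ha : a ≠ G.origin d₀)
    (hl : G.IsWalk a l (G.origin d₀)) : G.len d₀.1 ≤ G.pathLength l := by
  induction l generalizing a with
  | nil => exact absurd hl ha
  | cons d l ih =>
    rw [pathLength_cons]
    by_cases hd : G.terminus d = G.origin d₀
    · rw [hd₀.eq_not_of_terminus_eq hd]
      exact le_add_of_nonneg_right (pathLength_nonneg l)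
    · exact (ih hd hl.2).trans (le_add_of_nonneg_left (G.len_pos d.1).le)

end IsPendant

end Pendant

section LeafPotential

open Classical in
variable (G) in
/-- The potential `max (0, δ - dist)` near the origin of an oriented edge, in edge coordinates. -/
noncomputable def leafProfile (d : E × Bool) (δ : ℝ) (e : E) : C(ℝ, ℝ) :=
  if e = d.1 then ⟨fun x => max 0 (δ - G.coord d x), by fun_prop⟩ else 0

theorem leafProfile_self (d : E × Bool) (δ x : ℝ) :
    G.leafProfile d δ d.1 x = max 0 (δ - G.coord d x) := by
  simp [leafProfile]

theorem leafProfile_of_ne {d : E × Bool} {e : E} (he : e ≠ d.1) (δ x : ℝ) :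
    G.leafProfile d δ e x = 0 := by
  simp [leafProfile, he]

theorem leafProfile_nonneg (d : E × Bool) (δ : ℝ) (e : E) (x : ℝ) : 0 ≤ G.leafProfile d δ e x := by
  obtain rfl | he := eq_or_ne e d.1
  · rw [leafProfile_self]
    exact le_max_left _ _
  · rw [leafProfile_of_ne he]

theorem sum_integral_leafProfile_pos [Fintype E] (d : E × Bool) {δ : ℝ} (hδ : 0 < δ) :
    0 < ∑ e, ∫ x in (0 : ℝ)..G.len e, G.leafProfile d δ e x := by
  refine Finset.sum_pos' (fun e _ => intervalIntegral.integral_nonneg (G.len_pos e).le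
    fun x _ => leafProfile_nonneg d δ e x) ⟨d.1, Finset.mem_univ _, ?_⟩
  have hlen := G.len_pos d.1
  refine intervalIntegral.integral_pos hlen (by fun_prop) (fun x _ => leafProfile_nonneg d δ _ x)
    ⟨G.coord d 0, coord_mem_Icc (left_mem_Icc.2 hlen.le), ?_⟩
  rw [leafProfile_self, coord_coord, sub_zero]
  exact lt_max_of_lt_right hδ

theorem leafProfile_le (d : E × Bool) {δ : ℝ} (hδ : 0 ≤ δ) {e : E} {x : ℝ}
    (hx : x ∈ Icc 0 (G.len e)) : G.leafProfile d δ e x ≤ δ := by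
  obtain rfl | he := eq_or_ne e d.1
  · rw [leafProfile_self]
    exact max_le hδ (sub_le_self _ (coord_mem_Icc hx).1)
  · rwa [leafProfile_of_ne he]

open Classical in
variable (G) in
/-- The potential `max (0, δ - dist)` near the origin of an oriented edge. -/
noncomputable def leafPotential (d : E × Bool) (δ : ℝ) : G.Point → ℝ
  | Point.vertex w => if w = G.origin d then δ else 0
  | Point.interior e x _ => G.leafProfile d δ e x

theorem leafPotential_mem_Icc (d : E × Bool) {δ : ℝ} (hδ : 0 ≤ δ) (x : G.Point) :
    G.leafPotential d δ x ∈ Icc 0 δ := by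
  rcases x with w | ⟨e, x, hx⟩
  · simp only [leafPotential]
    split_ifs
    · exact right_mem_Icc.2 hδ
    · exact left_mem_Icc.2 hδ
  · exact ⟨leafProfile_nonneg d δ e x, leafProfile_le d hδ (Ioo_subset_Icc_self hx)⟩

variable {d₀ d : E × Bool} {δ : ℝ} {a b : V} {l : List (E × Bool)}

theorem eqOnEdges_leafPotential (hd₀ : G.IsPendant d₀) (hδ : 0 ≤ δ) (hδl : δ ≤ G.len d₀.1) :
    EqOnEdges (G.leafPotential d₀ δ) (G.leafProfile d₀ δ) := by
  have h_end : ∀ d, G.leafPotential d₀ δ (Point.vertex (G.origin d)) =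
      G.leafProfile d₀ δ d.1 (G.coord d 0) := fun d => by
    obtain hd | hd := eq_or_ne d.1 d₀.1
    · rw [hd, leafProfile_self]
      obtain rfl | rfl := eq_or_eq_not_of_fst_eq hd
      · rw [coord_coord, sub_zero, max_eq_right hδ]
        exact if_pos rfl
      · rw [coord_not, sub_zero, coord_coord, max_eq_left (sub_nonpos.2 hδl), origin_not]
        exact if_neg hd₀.terminus_ne_origin
    · rw [leafProfile_of_ne hd]
      exact if_neg fun h => hd (congrArg Prod.fst (hd₀ d h))
  intro e x hx
  obtain rfl | rfl | h := eq_endpoints_or_mem_Ioo_of_mem_Icc hx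
  · simpa [pt_zero, coord, origin] using h_end (e, true)
  · simpa [pt_len, coord, origin] using h_end (e, false)
  · rw [pt_of_mem_Ioo h]
    rfl

theorem leafPotential_pt_coord (hd₀ : G.IsPendant d₀) (hδ : 0 ≤ δ) (hδl : δ ≤ G.len d₀.1) {t : ℝ}
    (ht : t ∈ Icc 0 (G.len d₀.1)) :
    G.leafPotential d₀ δ (G.pt d₀.1 (G.coord d₀ t)) = max 0 (δ - t) := by
  rw [eqOnEdges_leafPotential hd₀ hδ hδl _ _ (coord_mem_Icc ht), leafProfile_self, coord_coord]

theorem leafPotential_trace [DecidableEq V] (hd₀ : G.IsPendant d₀) (hδ : 0 ≤ δ)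
    (hδl : δ ≤ G.len d₀.1) (hl : G.IsPath a l b) (ha : a ≠ G.origin d₀) {t : ℝ}
    (ht : t ∈ Icc 0 (G.pathLength l)) : G.leafPotential d₀ δ (G.trace a l t) =
      if b = G.origin d₀ then max 0 (δ - (G.pathLength l - t)) else 0 := by
  induction l generalizing a t with
  | nil =>
    obtain rfl : a = b := hl.1
    rw [if_neg ha]
    exact if_neg ha
  | cons d l ih =>
    by_cases hd : G.terminus d = G.origin d₀
    · obtain rfl := hd₀.eq_nil_of_isPath_cons hl hd
      obtain rfl : G.terminus d = b := hl.1.2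
      have hlen : G.pathLength [d] = G.len d.1 := add_zero _
      rw [hlen] at ht ⊢
      rw [if_pos hd, trace_cons_of_le _ _ _ ht.2]
      obtain rfl := hd₀.eq_not_of_terminus_eq hd
      rw [coord_not, leafPotential_pt_coord hd₀ hδ hδl ⟨sub_nonneg.2 ht.2, sub_le_self _ ht.1⟩]
    · obtain ⟨⟨rfl, hwalk⟩, hnodup⟩ := hl
      rw [pathLength_cons] at ht ⊢
      rcases le_or_gt t (G.len d.1) with htd | htd
      · rw [trace_cons_of_le _ _ _ htd,
          eqOnEdges_leafPotential hd₀ hδ hδl _ _ (coord_mem_Icc ⟨ht.1, htd⟩),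
          leafProfile_of_ne (fst_ne_of_origin_ne_of_terminus_ne ha hd)]
        split_ifs with hb
        · have := hd₀.len_le_pathLength hd (hb ▸ hwalk)
          rw [max_eq_left (by linarith)]
        · rfl
      · rw [trace_cons_of_lt _ _ _ htd, ih ⟨hwalk, (List.nodup_cons.1 hnodup).2⟩ hd
          ⟨by linarith, by linarith [ht.2]⟩,
          (by ring : G.pathLength l - (t - G.len d.1) = G.len d.1 + G.pathLength l - t)]

theorem leafPotential_trace_origin (hd₀ : G.IsPendant d₀) (hδ : 0 ≤ δ) (hδl : δ ≤ G.len d₀.1)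
    (hl : G.IsPath (G.origin d₀) l b) (hb : b ≠ G.origin d₀) {t : ℝ}
    (ht : t ∈ Icc 0 (G.pathLength l)) :
    G.leafPotential d₀ δ (G.trace (G.origin d₀) l t) = max 0 (δ - t) := by
  classical
  cases l with
  | nil => exact absurd hl.1.symm hb
  | cons d l =>
    obtain ⟨⟨hd, hwalk⟩, hnodup⟩ := hl
    obtain rfl := hd₀ d hd
    rw [pathLength_cons] at ht
    rcases le_or_gt t (G.len d.1) with htd | htd
    · rw [trace_cons_of_le _ _ _ htd, leafPotential_pt_coord hd₀ hδ hδl ⟨ht.1, htd⟩]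
    · rw [trace_cons_of_lt _ _ _ htd, leafPotential_trace hd₀ hδ hδl
        ⟨hwalk, (List.nodup_cons.1 hnodup).2⟩ hd₀.terminus_ne_origin
        ⟨by linarith, by linarith [ht.2]⟩, if_neg hb, max_eq_left (by linarith)]

theorem convexOn_max_zero_mul_add {s : Set ℝ} (hs : Convex ℝ s) (m c : ℝ) :
    ConvexOn ℝ s fun t => max 0 (m * t + c) :=
  (convexOn_const 0 hs).sup (((LinearMap.mulLeft ℝ m).convexOn hs).add_const c)

theorem convexOn_leafPotential (hd₀ : G.IsPendant d₀) (hδ : 0 ≤ δ) (hδl : δ ≤ G.len d₀.1)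
    (hab : a ≠ b) (hl : G.IsPath a l b) :
    ConvexOn ℝ (Icc 0 (G.pathLength l)) fun t => G.leafPotential d₀ δ (G.trace a l t) := by
  classical
  have hconv : Convex ℝ (Icc 0 (G.pathLength l)) := convex_Icc _ _
  obtain rfl | ha := eq_or_ne a (G.origin d₀)
  · refine (convexOn_max_zero_mul_add hconv (-1) δ).congr fun t ht => ?_
    simp only [leafPotential_trace_origin hd₀ hδ hδl hl hab.symm ht, neg_one_mul,
      neg_add_eq_sub]
  obtain rfl | hb := eq_or_ne b (G.origin d₀)
  · refine (convexOn_max_zero_mul_add hconv 1 (δ - G.pathLength l)).congr fun t ht => ?_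
    simp only [leafPotential_trace hd₀ hδ hδl hl ha ht, if_pos, one_mul]
    ring_nf
  · refine (convexOn_const 0 hconv).congr fun t ht => ?_
    simp only [leafPotential_trace hd₀ hδ hδl hl ha ht, if_neg hb]

theorem smul_leafPotential_mem_convexClass [DecidableEq V] [Fintype E] (hd₀ : G.IsPendant d₀)
    (hδ : 0 ≤ δ) (hδl : δ ≤ G.len d₀.1) {s M : ℝ} (hs : 0 ≤ s) (hsM : s * δ ≤ M) :
    s • G.leafPotential d₀ δ ∈ G.convexClass M := by
  refine ⟨fun x => ?_, fun a b _ _ hab l hl => (convexOn_leafPotential hd₀ hδ hδl hab hl).smul hs⟩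
  obtain ⟨hnonneg, hle⟩ := leafPotential_mem_Icc d₀ hδ x
  exact ⟨mul_nonneg hs hnonneg, (mul_le_mul_of_nonneg_left hle hs).trans hsM⟩

end LeafPotential

end MetricGraph

namespace MetricGraph

open SobolevPair Filter Topology

variable {V E : Type*} [Fintype V] [Fintype E] {G : MetricGraph V E} {k : G.SobolevPair}

section GroundState

theorem value_eq_of_dirichletForm_self_eq_zero (hG : G.toSimpleGraph.Connected)
    (hk : k ∈ G.sobolevSpace) (hzero : G.dirichletForm k k = 0) (v : V) (e : E) (x : ℝ) :
    value e k x = k.1 v := by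
  have hderiv : ∀ e, k.2 e = 0 := fun e => by
    rw [dirichletForm_apply, Finset.sum_eq_zero_iff_of_nonneg fun _ _ => real_inner_self_nonneg]
      at hzero
    exact inner_self_eq_zero.1 (hzero e (Finset.mem_univ e))
  have hedge : ∀ d : E × Bool, k.1 (G.origin d) = k.1 (G.terminus d) := by
    have hsrc : ∀ e, k.1 (G.src e) = k.1 (G.tgt e) := fun e =>
      (value_of_snd_eq_zero (hderiv e) _).symm.trans (hk e)
    rintro ⟨e, _ | _⟩
    · exact (hsrc e).symm
    · exact hsrc e
  have hwalk : ∀ {a b}, G.toSimpleGraph.Walk a b → k.1 a = k.1 b := fun w => by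
    induction w with
    | nil => rfl
    | cons hadj _ ih =>
      obtain ⟨d, rfl, rfl⟩ := exists_origin_terminus_of_adj hadj
      exact (hedge d).trans ih
  obtain ⟨w⟩ := hG.preconnected (G.src e) v
  rw [value_of_snd_eq_zero (hderiv e), hwalk w]

theorem dirichletForm_self_pos_of_sq_lt (hG : G.toSimpleGraph.Connected) (hk : k ∈ G.sobolevSpace)
    {v : V} (hlt : k.1 v ^ 2 * G.totalLength < G.massForm k k) : 0 < G.dirichletForm k k := by
  refine (dirichletForm_self_nonneg k).lt_of_ne fun hzero => hlt.ne ?_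
  have hconst := value_eq_of_dirichletForm_self_eq_zero hG hk hzero.symm v
  simp only [massForm_apply, hconst, intervalIntegral.integral_const, sub_zero, smul_eq_mul,
    ← Finset.sum_mul, totalLength, sq]
  exact mul_comm _ _

end GroundState

section MeanValue

theorem weightForm_self_le {p : E → C(ℝ, ℝ)} {m : ℝ} (hp : ∀ e x, 0 ≤ p e x)
    (hm : ∀ e, ∀ x ∈ Icc 0 (G.len e), p e x ≠ 0 → value e k x ^ 2 ≤ m) :
    G.weightForm p k k ≤ m * ∑ e, ∫ x in (0 : ℝ)..G.len e, p e x := by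
  rw [weightForm_apply, Finset.mul_sum]
  refine Finset.sum_le_sum fun e _ => ?_
  rw [← intervalIntegral.integral_const_mul]
  refine intervalIntegral.integral_mono_on (G.len_pos e).le
    (Continuous.intervalIntegrable (by fun_prop) _ _)
    (Continuous.intervalIntegrable (by fun_prop) _ _) fun x hx => ?_
  obtain h0 | h0 := eq_or_ne (p e x) 0
  · simp [h0]
  · rw [mul_comm m, ← sq]
    exact mul_le_mul_of_nonneg_left (hm e x hx h0) (hp e x)

theorem exists_weightForm_leafProfile_lt {d : E × Bool} {c : ℝ}
    (hlt : value d.1 k (G.coord d 0) ^ 2 < c) :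
    ∃ δ > 0, δ ≤ G.len d.1 ∧ G.weightForm (G.leafProfile d δ) k k <
      c * ∑ e, ∫ x in (0 : ℝ)..G.len e, G.leafProfile d δ e x := by
  obtain ⟨m, hm, hmc⟩ := exists_between hlt
  have hcont : Continuous fun t => value d.1 k (G.coord d t) ^ 2 := by fun_prop
  obtain ⟨ε, hε, hball⟩ :=
    Metric.eventually_nhds_iff.1 ((hcont.tendsto 0).eventually_lt_const hm)
  have hδ := lt_min hε (G.len_pos d.1)
  refine ⟨_, hδ, min_le_right _ _, (weightForm_self_le (m := m) (leafProfile_nonneg d _)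
    fun e x hx hne => ?_).trans_lt
      (mul_lt_mul_of_pos_right hmc (sum_integral_leafProfile_pos d hδ))⟩
  obtain rfl : e = d.1 := by
    by_contra he
    exact hne (leafProfile_of_ne he _ _)
  have hxε : G.coord d x < ε := by
    by_contra! h
    refine hne ?_
    rw [leafProfile_self, max_eq_left (sub_nonpos.2 ((min_le_left _ _).trans h))]
  have := hball (y := G.coord d x) (by rwa [Real.dist_0_eq_abs, abs_of_nonneg (coord_mem_Icc hx).1])
  rw [coord_coord] at this
  exact this.le

end MeanValue

section Minimizer

variable [DecidableEq V]

theorem IsPendant.exists_mem_convexClass_gap_lt (hG : G.toSimpleGraph.Connected) {d : E × Bool}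
    (hd : G.IsPendant d)
    (hk : IsWeakEigenvector (G.dirichletForm + G.weightForm 0) G.massForm G.sobolevSpace
      (G.eigenvalue 0 2) k)
    (hlt : k.1 (G.origin d) ^ 2 < G.massForm k k / G.totalLength) {M : ℝ} (hM : 0 < M) :
    ∃ q ∈ G.convexClass M, G.gap q < G.gap 0 := by
  have : Nonempty E := ⟨d.1⟩
  have hL : 0 < G.totalLength := totalLength_pos
  have hkpos : 0 < G.massForm k k := (div_pos_iff_of_pos_right hL).1 ((sq_nonneg _).trans_lt hlt)
  have hlam : 0 < G.eigenvalue 0 2 := by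
    have hD := dirichletForm_self_pos_of_sq_lt hG hk.1 ((lt_div_iff₀ hL).1 hlt)
    rw [← dirichletForm_add_weightForm_zero_apply, hk.2 k hk.1] at hD
    exact pos_of_mul_pos_left hD hkpos.le
  have hvalue : value d.1 k (G.coord d 0) = k.1 (G.origin d) := by
    rw [← eqOnEdges_toFun hk.1 _ _ (coord_mem_Icc (left_mem_Icc.2 (G.len_pos _).le)),
      pt_coord_zero]
    rfl
  obtain ⟨δ, hδ, hδl, hmean⟩ := exists_weightForm_leafProfile_lt (hvalue ▸ hlt)
  have hmean' : G.weightForm (G.leafProfile d δ) k k / G.massForm k k <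
      (∑ e, ∫ x in (0 : ℝ)..G.len e, G.leafProfile d δ e x) / G.totalLength := by
    rwa [div_lt_iff₀ hkpos, div_mul_comm]
  obtain ⟨s, ⟨hs, hsM⟩, hgap⟩ := ((eventually_nhdsGT_zero_mul_le hM δ).and
    (eventually_gap_smul_lt (surjective_origin hG) (eqOnEdges_leafPotential hd hδ.le hδl) hlam hk
      hkpos hmean')).exists
  exact ⟨_, smul_leafPotential_mem_convexClass hd hδ.le hδl hs.le hsM, hgap⟩

omit [Fintype V] in
theorem not_isMinOn_gap (hG : G.toSimpleGraph.Connected) {u : G.Point → ℝ}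
    (hu : G.IsEigenfunction 0 (G.eigenvalue 0 2) u) {v : V} (hv : G.IsLeaf v)
    (hlt : u (Point.vertex v) ^ 2 < 1 / G.totalLength * G.integral fun x => u x ^ 2) {M : ℝ}
    (hM : 0 < M) : ¬ IsMinOn G.gap (G.convexClass M) 0 := fun hmin => by
  obtain ⟨d, rfl, hd⟩ := hv.exists_isPendant
  have : Nonempty E := ⟨d.1⟩
  have := Fintype.ofSurjective G.origin (surjective_origin hG)
  obtain ⟨k, hk, rfl⟩ := hu.exists_isWeakEigenvector eqOnEdges_zero
  rw [integral_toFun_sq hk.1, one_div_mul_eq_div] at hlt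
  obtain ⟨q, hq, hgap⟩ := hd.exists_mem_convexClass_gap_lt hG hk hlt hM
  exact hgap.not_ge (isMinOn_iff.1 hmin q hq)

end Minimizer

end MetricGraph

open MetricGraph in
theorem mainTheorem5_general {V E : Type*} [DecidableEq V] [Fintype E]
    (G : MetricGraph V E) (hG : G.toSimpleGraph.Connected)
    (u₂ : G.Point → ℝ) (hu₂ : G.IsEigenfunction 0 (G.eigenvalue 0 2) u₂)
    (v : V) (hv : G.IsLeaf v) :
    (u₂ (MetricGraph.Point.vertex v) ^ 2 < 1 / G.totalLength * G.integral (fun x => u₂ x ^ 2) →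
      ∀ M : ℝ, 0 < M → ¬ IsMinOn G.gap (G.convexClass M) 0) ∧
    (u₂ (MetricGraph.Point.vertex v) = 0 →
      ∀ M : ℝ, 0 < M → ¬ IsMinOn G.gap (G.convexClass M) 0) := by
  obtain ⟨d, -, -⟩ := hv.exists_isPendant
  have : Nonempty E := ⟨d.1⟩
  refine ⟨fun hlt M => not_isMinOn_gap hG hu₂ hv hlt, fun hzero M => not_isMinOn_gap hG hu₂ hv ?_⟩
  rw [hzero, zero_pow two_ne_zero]
  exact mul_pos (one_div_pos.2 totalLength_pos)
    (integral_sq_pos (surjective_origin hG) eqOnEdges_zero hu₂)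

theorem mainTheorem5 {V E : Type*} [Fintype V] [DecidableEq V] [Fintype E]
    (G : MetricGraph V E) (hG : G.IsTree)
    (u₂ : G.Point → ℝ) (hu₂ : G.IsEigenfunction 0 (G.eigenvalue 0 2) u₂)
    (v : V) (hv : G.IsLeaf v) :
    (u₂ (MetricGraph.Point.vertex v) ^ 2 < 1 / G.totalLength * G.integral (fun x => u₂ x ^ 2) →
      ∀ M : ℝ, 0 < M → ¬ IsMinOn G.gap (G.convexClass M) 0) ∧
    (u₂ (MetricGraph.Point.vertex v) = 0 →
      ∀ M : ℝ, 0 < M → ¬ IsMinOn G.gap (G.convexClass M) 0) :=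
  mainTheorem5_general G hG.isTree.connected u₂ hu₂ v hv
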